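/- Let $K$ be a field and let $n,k,t$ be integers with $k\ge 1$, $t\ge 1$ and $n=kt+l$ for some integer $l\ge 1$. For $m\ge 0$ let $P_m$ be the path graph on $[m]=\{1,\dots,m\}$ and let $I_{m,t}\subseteq K[x_1,\dots,x_m]$ be its $t$-path ideal, generated by the monomials $x_{i_1}\cdots x_{i_t}$ such that $i_1,\dots,i_t$ is a path on $t$ vertices of $P_m$. For $j\ge 1$ let $I_{m,t}^{[j]}$ be its $j$-th squarefree power, the ideal generated by the squarefree monomials among the minimal monomial generators of $I_{m,t}^j$. Let $\Sigma_{m,t}^{[j]}=\{F\subseteq [m] : \prod_{i\in F}x_i\notin I_{m,t}^{[j]}\}$ be the Stanley–Reisner complex of $I_{m,t}^{[j]}$, and let $\Delta_{m,t}^{[j]}=\{[m]\setminus F : F\subseteq[m],\ F\notin \Sigma_{m,t}^{[j]}\}$ be its Alexander dual. Let $\Delta_{m,t}^{[0]}$ be the full simplex on $[m]$ (all subsets of $[m]$). Write $\Sigma(\Delta)=\Delta*\langle\{v\},\{w\}\rangle$ for the (simplicial) suspension of a simplicial complex $\Delta$, where $v\ne w$ are two new vertices, so that $\Sigma(\{\emptyset\})=S^0$;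 put $\Sigma^2(\Delta)=\Sigma(\Sigma(\Delta))$. Below, a complex also denotes its geometric realization, $\vee$ denotes the wedge sum and $\simeq$ denotes homotopy equivalence. 1. If $l\le t$, then $$\Delta_{n,t}^{[k]}\simeq \Delta_{n-t,t}^{[k-1]}\vee \Sigma\bigl(\Delta_{n-t-1,t}^{[k-1]}\bigr).$$ 2. If $l>t$, then $$\Delta_{n,t}^{[k]}\simeq \Delta_{n-t,t}^{[k-1]}\vee \Sigma\bigl(\Delta_{n-t-1,t}^{[k-1]}\bigr)\vee\Sigma^2\bigl(\Delta_{n-t-1,t}^{[k]}\bigr).$$ In both cases all the spaces in the wedge sum are non-empty, and the equivalence holds for every choice of base points in them. -/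

import Mathlib

open scoped ContinuousMap

namespace PathPowers

/-! ### Simplicial complexes

A simplicial complex on the vertex set `V` is a family of finite subsets of `V` that is closed
under passing to subsets.  The empty set counts as a face, and the void family is allowed, so that
Alexander duality is defined for every complex. -/

/-- Abstract simplicial complexes on the vertex set `V`. -/
abbrev SComplex (V : Type*) := LowerSet (Finset V)

/-- The Alexander dual `{V \ F : F ∉ Δ}`. -/
def alexanderDual {V : Type*} [Fintype V] [DecidableEq V] (Δ : SComplex V) : SComplex V where
  carrier := {G | ∃ F : Finset V, F ∉ Δ ∧ G = Fᶜ}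
  lower' := by
    rintro G G' hG ⟨F, hF, rfl⟩
    refine ⟨G'ᶜ, fun h => hF (Δ.lower ?_ h), (compl_compl G').symm⟩
    exact le_compl_comm.mp hG

/-- The join of two complexes, on the disjoint union of the two vertex sets: the faces are the
disjoint unions of a face of `Δ₁` and a face of `Δ₂`. -/
def join {V W : Type*} (Δ₁ : SComplex V) (Δ₂ : SComplex W) : SComplex (V ⊕ W) where
  carrier := {F | F.toLeft ∈ Δ₁ ∧ F.toRight ∈ Δ₂}
  lower' := fun _ _ h hF =>
    ⟨Δ₁.lower (Finset.toLeft_monotone h) hF.1, Δ₂.lower (Finset.toRight_monotone h) hF.2⟩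

/-- The complex `⟨{v}, {w}⟩` consisting of two isolated points. -/
def twoPoints : SComplex Bool where
  carrier := {F | F.card ≤ 1}
  lower' := fun _ _ h hF => (Finset.card_le_card h).trans hF

/-- The suspension `Σ Δ = Δ * ⟨{v}, {w}⟩`, with two new vertices `v`, `w`. -/
def suspension {V : Type*} (Δ : SComplex V) : SComplex (V ⊕ Bool) :=
  join Δ twoPoints

/-- The geometric realization of a complex on a finite vertex set, as a subspace of `ℝ^V`:
the points of the standard simplex whose support is contained in a face. -/
def realization {V : Type*} [Fintype V] (Δ : SComplex V) : Set (V → ℝ) :=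
  {w | w ∈ stdSimplex ℝ V ∧ ∃ F ∈ Δ, ∀ v, v ∉ F → w v = 0}

/-! ### Wedge sums -/

/-- The wedge sum of the pointed spaces `(X, x)` and `(Y, y)`: the disjoint union with `x` and `y`
identified, in the quotient topology. -/
def Wedge {X Y : Type*} (x : X) (y : Y) : Type _ :=
  Quot fun p q : X ⊕ Y => p = Sum.inl x ∧ q = Sum.inr y

instance {X Y : Type*} [TopologicalSpace X] [TopologicalSpace Y] (x : X) (y : Y) :
    TopologicalSpace (Wedge x y) :=
  inferInstanceAs (TopologicalSpace (Quot _))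

/-- The base point of a wedge sum. -/
def Wedge.base {X Y : Type*} (x : X) (y : Y) : Wedge x y :=
  Quot.mk _ (Sum.inl x)

/-! ### Monomial ideals -/

section Ideals

variable {V : Type*} {K : Type*} [Field K]

/-- The `t`-path ideal of the graph `G`: it is generated by the products `x_{i_1} ⋯ x_{i_t}` over
all paths `i_1, …, i_t` on `t` vertices of `G`. -/
noncomputable def tPathIdeal (K : Type*) [Field K] (G : SimpleGraph V) (t : ℕ) :
    Ideal (MvPolynomial V K) :=
  Ideal.span {f | ∃ (u v : V) (p : G.Walk u v), p.IsPath ∧ p.support.length = t ∧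
    f = (p.support.map MvPolynomial.X).prod}

/-- The (exponents of the) minimal monomial generators `G(I)` of a monomial ideal `I`: the monomials
of `I` that are minimal for divisibility. -/
def minimalGenerators (I : Ideal (MvPolynomial V K)) : Set (V →₀ ℕ) :=
  {a | Minimal (fun b => MvPolynomial.monomial b (1 : K) ∈ I) a}

/-- The `k`-th squarefree power `I^[k]`: the ideal generated by the squarefree elements of
`G(I^k)`. -/
noncomputable def squarefreePower (I : Ideal (MvPolynomial V K)) (k : ℕ) :
    Ideal (MvPolynomial V K) :=
  Ideal.span {f | ∃ a ∈ minimalGenerators (I ^ k), (∀ i, a i ≤ 1) ∧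
    f = MvPolynomial.monomial a (1 : K)}

/-- The Stanley–Reisner complex of a squarefree monomial ideal `I`: a finite set `F` is a face if
and only if `x_F = ∏_{i ∈ F} x_i` is not in `I`. -/
def stanleyReisner (I : Ideal (MvPolynomial V K)) : SComplex V where
  carrier := {F | ∏ i ∈ F, (MvPolynomial.X i : MvPolynomial V K) ∉ I}
  lower' := fun _ _ h hF hI => hF (I.mem_of_dvd (Finset.prod_dvd_prod_of_subset _ _ _ h) hI)

end Ideals

/-- The complex `Δ_{n,t}^{[k]}` on `n` vertices.  For `k ≥ 1` it is the Alexander dual of the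
Stanley–Reisner complex of the `k`-th squarefree power of the `t`-path ideal of the path graph
`P_n`; for `k = 0` it is the full simplex. -/
noncomputable def pathComplex (K : Type*) [Field K] (n t : ℕ) : ℕ → SComplex (Fin n)
  | 0 => ⊤
  | k + 1 => alexanderDual (stanleyReisner
      (squarefreePower (tPathIdeal K (SimpleGraph.pathGraph n) t) (k + 1)))

end PathPowers

/-! A squarefree monomial lies in the squarefree power exactly when it lies in the ordinary power.
Hence a set of vertices is a face exactly when its complement contains `k` disjoint intervals of
length `t` (`pathComplex_eq`), and the field disappears. Write Δ(k, n) for this complex,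
`packComplex t k n`, with vertices 0, …, n - 1.

Write k + 1 for the power and m + 1 + t for the number of vertices. If a face contains some i with m
+ 1 ≤ i < m + t, no interval fits to the right of i, so the last vertex m + t may be inserted or
removed freely. These faces collapse away (`packComplex_equiv_coneAttach`). What is left is X = Δ(k,
m + 1), because the last interval can be pushed to the right end, together with a cone of apex m + t
over a complex L (`packBase`). The same reasoning at the vertex m shows that L is Δ(k, m) with a
cone attached along Δ(k + 1, m) (`mapComplex_lastEmbedding`).

The topological input is `coneAttach_equiv_wedge`: if X contains the cone over L with some apex a,
then attaching another cone over L gives X ∨ ΣL. So Δ(k + 1, m + 1 + t) ≃ X ∨ ΣL. If m < (k + 1)t,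
the complex Δ(k + 1, m) is void and L is Δ(k, m). Otherwise suspension commutes with attaching a
cone, and the same input splits ΣL as ΣΔ(k, m) ∨ Σ²Δ(k + 1, m).

Base points need care. Equivalences are pointed so that they can be substituted into wedge sums, and
points of realizations are well-pointed, so base points move along paths. X is path connected if m >
kt (`joined_packComplex`); if m = kt then L = {∅} and every vertex of X can serve as a. A suspension
may be S⁰, so the pole used for gluing is kept variable. -/

namespace PathPowers

open unitInterval Topology

/-! ### Pointed homotopy equivalences -/

/-- The pointed spaces `(X, x)` and `(Y, y)` are homotopy equivalent relative to the base points. -/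
def PointedEquiv {X Y : Type*} [TopologicalSpace X] [TopologicalSpace Y] (x : X) (y : Y) : Prop :=
  ∃ (f : C(X, Y)) (g : C(Y, X)), f x = y ∧ g y = x ∧
    (g.comp f).HomotopicRel (.id X) {x} ∧ (f.comp g).HomotopicRel (.id Y) {y}

section Pointed

variable {X Y Z : Type*} [TopologicalSpace X] [TopologicalSpace Y] [TopologicalSpace Z]

theorem homotopicRel_of_continuous {f g : C(X, Y)} {S : Set X} (H : I × X → Y) (hH : Continuous H)
    (h0 : ∀ x, H (0, x) = f x) (h1 : ∀ x, H (1, x) = g x) (hS : ∀ t, ∀ x ∈ S, H (t, x) = f x) :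
    f.HomotopicRel g S :=
  ⟨{ toFun := H
     continuous_toFun := hH
     map_zero_left := h0
     map_one_left := h1
     prop' := hS }⟩

theorem _root_.ContinuousMap.HomotopicRel.precomp {f g : C(Y, Z)} {T : Set Y}
    (h : f.HomotopicRel g T) (k : C(X, Y)) {S : Set X} (hk : Set.MapsTo k S T) :
    (f.comp k).HomotopicRel (g.comp k) S := by
  obtain ⟨H⟩ := h
  refine homotopicRel_of_continuous (fun p => H (p.1, k p.2)) (by fun_prop) ?_ ?_ ?_
  · intro x; simp
  · intro x; simp
  · intro t x hx; exact H.eq_fst t (hk hx)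

namespace PointedEquiv

theorem symm {x : X} {y : Y} (h : PointedEquiv x y) : PointedEquiv y x := by
  obtain ⟨f, g, hf, hg, h1, h2⟩ := h
  exact ⟨g, f, hg, hf, h2, h1⟩

theorem trans {x : X} {y : Y} {z : Z} (h : PointedEquiv x y) (h' : PointedEquiv y z) :
    PointedEquiv x z := by
  obtain ⟨f, g, hf, hg, h1, h2⟩ := h
  obtain ⟨f', g', hf', hg', h1', h2'⟩ := h'
  refine ⟨f'.comp f, g.comp g', by simp [hf, hf'], by simp [hg, hg'], ?_, ?_⟩
  · have := (h1'.precomp f (S := {x}) (by simp [hf])).comp_continuousMap g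
    exact this.trans h1
  · have := (h2.precomp g' (S := {z}) (by simp [hg'])).comp_continuousMap f'
    exact this.trans h2'

theorem of_homeomorph (e : X ≃ₜ Y) (x : X) : PointedEquiv x (e x) :=
  ⟨e, e.symm, rfl, e.symm_apply_apply x, by
    have : (e.symm : C(Y, X)).comp (e : C(X, Y)) = .id X := by ext; simp
    rw [this]; exact .refl _, by
    have : (e : C(X, Y)).comp (e.symm : C(Y, X)) = .id Y := by ext; simp
    rw [this]; exact .refl _⟩

theorem refl (x : X) : PointedEquiv x x := of_homeomorph (.refl X) x

theorem nonempty_homotopyEquiv {x : X} {y : Y} (h : PointedEquiv x y) : Nonempty (X ≃ₕ Y) := by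
  obtain ⟨f, g, -, -, h1, h2⟩ := h
  exact ⟨⟨f, g, h1.homotopic, h2.homotopic⟩⟩

end PointedEquiv

end Pointed

/-! ### Maps out of quotients of a disjoint union -/

section Wedge

variable {X Y Z T : Type*} [TopologicalSpace X] [TopologicalSpace Y] [TopologicalSpace Z]
  [TopologicalSpace T]

theorem continuous_quot_sum {r : X ⊕ Y → X ⊕ Y → Prop} {f : Quot r → T}
    (h1 : Continuous fun a => f (Quot.mk r (Sum.inl a)))
    (h2 : Continuous fun b => f (Quot.mk r (Sum.inr b))) : Continuous f :=
  isQuotientMap_quot_mk.continuous_iff.2 (continuous_sum_dom.2 ⟨h1, h2⟩)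

/-- Homotopies may be built piecewise on a quotient because the product of a quotient map with the
locally compact space `I` is again a quotient map. -/
theorem continuous_prod_quot_sum {r : X ⊕ Y → X ⊕ Y → Prop} {f : I × Quot r → T}
    (h1 : Continuous fun p : I × X => f (p.1, Quot.mk r (Sum.inl p.2)))
    (h2 : Continuous fun p : I × Y => f (p.1, Quot.mk r (Sum.inr p.2))) : Continuous f := by
  refine IsQuotientMap.continuous_lift_prod_right (f := Quot.mk r) isQuotientMap_quot_mk ?_
  have : (fun p : I × (X ⊕ Y) => f (p.1, Quot.mk r p.2)) =
      Sum.elim (fun p : I × X => f (p.1, Quot.mk r (Sum.inl p.2)))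
        (fun p : I × Y => f (p.1, Quot.mk r (Sum.inr p.2))) ∘
        (Homeomorph.prodSumDistrib (X := I) (Y := X) (Z := Y)) := by
    ext ⟨t, a | b⟩ <;> rfl
  rw [this]
  exact (h1.sumElim h2).comp (Homeomorph.continuous _)

/-! ### Functoriality, commutativity and associativity of wedge sums. -/

namespace Wedge

/-- The inclusion of the first summand. -/
def inl (x : X) (y : Y) : C(X, Wedge x y) :=
  ⟨fun a => Quot.mk _ (Sum.inl a), continuous_quot_mk.comp continuous_inl⟩

/-- The inclusion of the second summand. -/
def inr (x : X) (y : Y) : C(Y, Wedge x y) :=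
  ⟨fun b => Quot.mk _ (Sum.inr b), continuous_quot_mk.comp continuous_inr⟩

theorem glue (x : X) (y : Y) : inl x y x = inr x y y := Quot.sound ⟨rfl, rfl⟩

theorem base_eq_inr (x : X) (y : Y) : base x y = inr x y y := glue x y

/-- The map out of a wedge sum given by its restrictions to the summands. -/
def lift {x : X} {y : Y} (f : X → T) (g : Y → T) (h : f x = g y) : Wedge x y → T :=
  Quot.lift (Sum.elim f g) (by rintro _ _ ⟨rfl, rfl⟩; exact h)

@[simp] theorem lift_inl {S : Type*} {x : X} {y : Y} (f : X → S) (g : Y → S) (h : f x = g y) (a : X) :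
    lift f g h (inl x y a) = f a := rfl

@[simp] theorem lift_inr {S : Type*} {x : X} {y : Y} (f : X → S) (g : Y → S) (h : f x = g y) (b : Y) :
    lift f g h (inr x y b) = g b := rfl

theorem ind {x : X} {y : Y} {P : Wedge x y → Prop} (h1 : ∀ a, P (inl x y a))
    (h2 : ∀ b, P (inr x y b)) (w : Wedge x y) : P w := by
  obtain ⟨a | b⟩ := w
  · exact h1 a
  · exact h2 b

theorem continuous_lift {x : X} {y : Y} {f : X → T} {g : Y → T} (h : f x = g y)
    (hf : Continuous f) (hg : Continuous g) : Continuous (lift f g h) :=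
  continuous_quot_sum hf hg

/-- The wedge sum of a pointed map with the identity. -/
def mapRight (x : X) {y : Y} {z : Z} (f : C(Y, Z)) (hf : f y = z) : C(Wedge x y, Wedge x z) :=
  ⟨lift (inl x z) (inr x z ∘ f) (by simp [hf, glue]),
    continuous_lift _ (inl x z).continuous ((inr x z).continuous.comp f.continuous)⟩

@[simp] theorem mapRight_inl (x : X) {y : Y} {z : Z} (f : C(Y, Z)) (hf : f y = z) (a : X) :
    mapRight x f hf (inl x y a) = inl x z a := rfl

@[simp] theorem mapRight_inr (x : X) {y : Y} {z : Z} (f : C(Y, Z)) (hf : f y = z) (b : Y) :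
    mapRight x f hf (inr x y b) = inr x z (f b) := rfl

theorem mapRight_homotopic {x : X} {y : Y} {f : C(Y, Y)} (hf : f y = y)
    (h : f.HomotopicRel (.id Y) {y}) :
    (mapRight x f hf).HomotopicRel (.id _) (Set.range (inl x y)) := by
  obtain ⟨H⟩ := h
  have hH : ∀ t, H (t, y) = y := fun t => by rw [H.eq_snd t rfl]; rfl
  refine homotopicRel_of_continuous
    (fun p => lift (inl x y) (fun b => inr x y (H (p.1, b))) (by rw [hH, glue]) p.2)
    (continuous_prod_quot_sum ?_ ?_) ?_ ?_ ?_
  · exact (inl x y).continuous.comp continuous_snd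
  · exact (inr x y).continuous.comp H.continuous
  · exact ind (fun a => rfl) (fun b => by simp)
  · exact ind (fun a => rfl) (fun b => by simp)
  · rintro t _ ⟨a, rfl⟩; rfl

/-- The maps and homotopies are constant on the first summand, so any point `a` of it, not only `x`,
can serve as base point. -/
theorem pointedEquiv_right (x : X) {y : Y} {z : Z} (h : PointedEquiv y z) (a : X) :
    PointedEquiv (inl x y a) (inl x z a) := by
  obtain ⟨f, g, hf, hg, h1, h2⟩ := h
  refine ⟨mapRight x f hf, mapRight x g hg, rfl, rfl, ?_, ?_⟩
  · obtain ⟨H⟩ := mapRight_homotopic (x := x) (f := g.comp f) (by simp [hf, hg]) h1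
    have e : (mapRight x g hg).comp (mapRight x f hf) =
        mapRight x (g.comp f) (by simp [hf, hg]) := by
      ext w; induction w using ind <;> rfl
    rw [e]
    exact ⟨⟨H.toHomotopy, fun t p hp => H.prop t p (by rw [hp]; exact ⟨a, rfl⟩)⟩⟩
  · obtain ⟨H⟩ := mapRight_homotopic (x := x) (f := f.comp g) (by simp [hf, hg]) h2
    have e : (mapRight x f hf).comp (mapRight x g hg) =
        mapRight x (f.comp g) (by simp [hf, hg]) := by
      ext w; induction w using ind <;> rfl
    rw [e]
    exact ⟨⟨H.toHomotopy, fun t p hp => H.prop t p (by rw [hp]; exact ⟨a, rfl⟩)⟩⟩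

/-- The wedge sum is commutative. -/
def comm (x : X) (y : Y) : Wedge x y ≃ₜ Wedge y x where
  toFun := lift (inr y x) (inl y x) (glue y x).symm
  invFun := lift (inr x y) (inl x y) (glue x y).symm
  left_inv := ind (fun _ => rfl) (fun _ => rfl)
  right_inv := ind (fun _ => rfl) (fun _ => rfl)
  continuous_toFun := continuous_lift _ (inr y x).continuous (inl y x).continuous
  continuous_invFun := continuous_lift _ (inr x y).continuous (inl x y).continuous

/-- The wedge sum is associative. -/
def assoc (x : X) (y : Y) (z : Z) : Wedge x (base y z) ≃ₜ Wedge (base x y) z where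
  toFun := lift (inl _ z ∘ inl x y)
    (lift (inl _ z ∘ inr x y) (inr (base x y) z) (by
      show inl (base x y) z (inr x y y) = _
      rw [← glue, ← glue]; rfl)) (by
      show inl (base x y) z (inl x y x) = inl (base x y) z (inr x y y)
      rw [glue])
  invFun := lift (lift (inl x _) (inr x _ ∘ inl y z) (glue x (base y z)))
    (inr x (base y z) ∘ inr y z) (by
      show inl x (base y z) x = inr x (base y z) (inr y z z)
      rw [← glue y z, glue]; rfl)
  left_inv := ind (fun _ => rfl) (ind (fun _ => rfl) (fun _ => rfl))
  right_inv := ind (ind (fun _ => rfl) (fun _ => rfl)) (fun _ => rfl)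
  continuous_toFun := continuous_lift _ ((inl _ z).continuous.comp (inl x y).continuous)
    (continuous_lift _ ((inl _ z).continuous.comp (inr x y).continuous) (inr _ z).continuous)
  continuous_invFun := continuous_lift _ (continuous_lift _ (inl x _).continuous
    ((inr x _).continuous.comp (inl y z).continuous))
    ((inr x _).continuous.comp (inr y z).continuous)

end Wedge

/-! ### Change of base point -/

/-- A point `y` of `Y` is well-pointed: some neighbourhood of it contracts to it inside `Y`. -/
def WellPointed (y : Y) : Prop :=
  ∃ (c : C(I × Y, Y)) (d : C(Y, I)), (∀ q, c (0, q) = q) ∧ (∀ t, c (t, y) = y) ∧ d y = 0 ∧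
    ∀ q, (d q : ℝ) ≤ 1 / 2 → c (1, q) = y

/-- The point that divides the segment from `u` to `e` in the ratio `s : 1 - s`. -/
def slide (e u s : I) : I :=
  ⟨(1 - s) * u + s * e, by
    have := s.2.1; have := s.2.2; have := u.2.1; have := u.2.2; have := e.2.1; have := e.2.2
    constructor
    · have := mul_nonneg (sub_nonneg.2 s.2.2) u.2.1
      have := mul_nonneg s.2.1 e.2.1
      linarith
    · have := mul_le_mul_of_nonneg_left u.2.2 (sub_nonneg.2 s.2.2)
      have := mul_le_mul_of_nonneg_left e.2.2 s.2.1
      linarith⟩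

theorem continuous_slide : Continuous fun p : I × I × I => slide p.1 p.2.1 p.2.2 := by
  unfold slide; fun_prop

@[simp] theorem slide_zero (e u : I) : slide e u 0 = u := by ext; simp [slide]

@[simp] theorem slide_one (e u : I) : slide e u 1 = e := by ext; simp [slide]

@[simp] theorem slide_self (e s : I) : slide e e s = e := by
  ext; simp only [slide]; ring

/-- The cylinder on `Y`, attached to `X` along a path of `X`. -/
def PathCylinder (γ : C(I, X)) (y : Y) : Type _ :=
  Quot fun p q : X ⊕ (Y × I) => ∃ u, p = Sum.inl (γ u) ∧ q = Sum.inr (y, u)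

instance (γ : C(I, X)) (y : Y) : TopologicalSpace (PathCylinder γ y) :=
  inferInstanceAs (TopologicalSpace (Quot _))

namespace PathCylinder

/-- The inclusion of `X`. -/
def inl (γ : C(I, X)) (y : Y) : C(X, PathCylinder γ y) :=
  ⟨fun a => Quot.mk _ (Sum.inl a), continuous_quot_mk.comp continuous_inl⟩

/-- The map from the cylinder. -/
def inr (γ : C(I, X)) (y : Y) : C(Y × I, PathCylinder γ y) :=
  ⟨fun b => Quot.mk _ (Sum.inr b), continuous_quot_mk.comp continuous_inr⟩

theorem glue (γ : C(I, X)) (y : Y) (u : I) : inl γ y (γ u) = inr γ y (y, u) :=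
  Quot.sound ⟨u, rfl, rfl⟩

/-- The map out of a path cylinder given by its restrictions to the pieces. -/
def lift {γ : C(I, X)} {y : Y} (f : X → T) (g : Y × I → T) (h : ∀ u, f (γ u) = g (y, u)) :
    PathCylinder γ y → T :=
  Quot.lift (Sum.elim f g) (by rintro _ _ ⟨u, rfl, rfl⟩; exact h u)

theorem ind {γ : C(I, X)} {y : Y} {P : PathCylinder γ y → Prop} (h1 : ∀ a, P (inl γ y a))
    (h2 : ∀ b, P (inr γ y b)) (w : PathCylinder γ y) : P w := by
  obtain ⟨a | b⟩ := w
  · exact h1 a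
  · exact h2 b

/-- The slice of the cylinder at height `e`, together with `X`, is the wedge sum at `γ e`. The whole
cylinder deforms to it with `X` fixed. As `e` is arbitrary, the wedge sums at both ends of the path
are compared with one space. -/
theorem pointedEquiv_wedge (γ : C(I, X)) {y : Y} (hy : WellPointed y) (e : I) (a : X) :
    PointedEquiv (Wedge.inl (γ e) y a) (inl γ y a) := by
  obtain ⟨c, d, c0, cy, dy, c1⟩ := hy
  let φ : C(Y, I) := ⟨fun q => Set.projIcc 0 1 zero_le_one (2 * (d q : ℝ)), by fun_prop⟩
  have φy : φ y = 0 := by simp [φ, dy]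
  have φ1 : ∀ q, 1 / 2 ≤ (d q : ℝ) → φ q = 1 := fun q hq => by
    exact Set.projIcc_of_right_le zero_le_one (by linarith)
  let f : C(Wedge (γ e) y, PathCylinder γ y) :=
    ⟨Wedge.lift (inl γ y) (fun q => inr γ y (q, e)) (glue γ y e),
      Wedge.continuous_lift _ (inl γ y).continuous (by fun_prop)⟩
  -- Near `y` the cylinder is sent into the path: `φ` grows from 0 at `y`, where the gluing forces
  -- the value `γ u`, to 1 at `d = 1/2`, where the value is `γ e`. Farther out the end map of the
  -- contraction takes over; it equals `y` at `d = 1/2`, so the two formulas agree there.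
  let ρ : Y × I → Wedge (γ e) y := fun p =>
    if (d p.1 : ℝ) ≤ 1 / 2 then Wedge.inl (γ e) y (γ (slide e p.2 (φ p.1)))
    else Wedge.inr (γ e) y (c (1, p.1))
  have hslide : Continuous fun p : Y × I => slide e p.2 (φ p.1) :=
    continuous_slide.comp (f := fun p : Y × I => (e, p.2, φ p.1)) (by fun_prop)
  have hρ : Continuous ρ := by
    refine Continuous.if_le (f := fun p : Y × I => (d p.1 : ℝ)) (g := fun _ => 1 / 2)
      ?_ (by fun_prop) (by fun_prop) (by fun_prop) ?_
    · exact (Wedge.inl (γ e) y).continuous.comp (γ.continuous.comp hslide)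
    · intro p hp
      rw [φ1 _ hp.ge, slide_one, c1 _ hp.le, Wedge.glue]
  have hρy : ∀ u, Wedge.inl (γ e) y (γ u) = ρ (y, u) := fun u => by
    simp [ρ, dy, φy]
  let g : C(PathCylinder γ y, Wedge (γ e) y) :=
    ⟨lift (Wedge.inl (γ e) y) ρ hρy,
      continuous_quot_sum (Wedge.inl (γ e) y).continuous hρ⟩
  refine ⟨f, g, rfl, rfl, ?_, ?_⟩
  · refine ContinuousMap.HomotopicRel.symm (homotopicRel_of_continuous
      (fun p => Wedge.lift (Wedge.inl (γ e) y) (fun q => Wedge.inr (γ e) y (c (p.1, q)))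
        (by rw [cy, Wedge.glue]) p.2)
      (continuous_prod_quot_sum ?_ ?_) ?_ ?_ ?_)
    · exact (Wedge.inl (γ e) y).continuous.comp continuous_snd
    · exact (Wedge.inr (γ e) y).continuous.comp c.continuous
    · exact Wedge.ind (fun a => rfl) (fun b => by simp [c0])
    · refine Wedge.ind (fun a => rfl) (fun b => ?_)
      show Wedge.inr (γ e) y (c (1, b)) = ρ (b, e)
      by_cases hb : (d b : ℝ) ≤ 1 / 2
      · simp only [ρ, hb, if_true, slide_self, c1 b hb, Wedge.glue]
      · simp only [ρ, hb, if_false]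
    · rintro t _ rfl; rfl
  · refine ContinuousMap.HomotopicRel.symm (homotopicRel_of_continuous
      (fun p => lift (inl γ y) (fun q => inr γ y (c (p.1, q.1), slide e q.2 (p.1 * φ q.1)))
        (fun u => by simp [cy, φy, glue]) p.2)
      (continuous_prod_quot_sum ?_ ?_) ?_ ?_ ?_)
    · exact (inl γ y).continuous.comp continuous_snd
    · refine (inr γ y).continuous.comp (Continuous.prodMk (by fun_prop) ?_)
      exact continuous_slide.comp (f := fun p : I × Y × I => (e, p.2.2, p.1 * φ p.2.1))
        (by fun_prop)
    · refine ind (fun a => rfl) (fun b => ?_)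
      show inr γ y (c (0, b.1), slide e b.2 (0 * φ b.1)) = inr γ y b
      simp [c0]
    · refine ind (fun a => rfl) (fun b => ?_)
      show inr γ y (c (1, b.1), slide e b.2 (1 * φ b.1)) = f (ρ b)
      rw [one_mul]
      by_cases hb : (d b.1 : ℝ) ≤ 1 / 2
      · simp only [ρ, hb, if_true, c1 _ hb]
        exact (glue γ y _).symm
      · simp only [ρ, hb, if_false]
        rw [φ1 _ (not_le.1 hb).le, slide_one]
        rfl
    · rintro t _ rfl; rfl

end PathCylinder

namespace Wedge

/-- The base point of the first summand of a wedge sum may be moved along a path. -/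
theorem pointedEquiv_of_joined {x x' : X} (h : Joined x x') {y : Y} (hy : WellPointed y) (a : X) :
    PointedEquiv (inl x y a) (inl x' y a) := by
  obtain ⟨γ⟩ := h
  have h0 := PathCylinder.pointedEquiv_wedge (γ : C(I, X)) hy 0 a
  have h1 := PathCylinder.pointedEquiv_wedge (γ : C(I, X)) hy 1 a
  have e0 : (γ : C(I, X)) 0 = x := γ.source
  have e1 : (γ : C(I, X)) 1 = x' := γ.target
  rw [e0] at h0
  rw [e1] at h1
  exact h0.trans h1.symm

/-- The base point of the second summand of a wedge sum may be moved along a path. -/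
theorem pointedEquiv_of_joined_right {x : X} (hx : WellPointed x) {y y' : Y} (h : Joined y y')
    (b : Y) : PointedEquiv (inr x y b) (inr x y' b) :=
  ((PointedEquiv.of_homeomorph (comm x y) (inr x y b)).trans
    (pointedEquiv_of_joined h hx b)).trans (PointedEquiv.of_homeomorph (comm y' x) (inl y' x b))

end Wedge

end Wedge

/-! ### Points and maps of geometric realizations -/

section Realization

variable {V W : Type*} [Fintype V] [Fintype W]

theorem isCompact_realization (K : SComplex V) : IsCompact (realization K) := by
  have : realization K =
      stdSimplex ℝ V ∩ ⋃ F ∈ (K : Set (Finset V)), {w | ∀ v, v ∉ F → w v = 0} := by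
    ext w; simp [realization]
  rw [this]
  refine (isCompact_stdSimplex ℝ V).inter_right ?_
  refine Set.Finite.isClosed_biUnion (Set.toFinite _) fun F _ => ?_
  simp only [Set.ofPred_forall]
  exact isClosed_iInter fun v => isClosed_iInter fun _ =>
    isClosed_eq (continuous_apply v) continuous_const

instance (K : SComplex V) : CompactSpace (realization K) :=
  isCompact_iff_compactSpace.1 (isCompact_realization K)

theorem single_mem_realization [DecidableEq V] {K : SComplex V} {v : V} (h : {v} ∈ K) :
    Pi.single v (1 : ℝ) ∈ realization K :=
  ⟨single_mem_stdSimplex ℝ v, {v}, h, fun u hu => by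
    rw [Pi.single_apply, if_neg (by simpa using hu)]⟩

/-- The point of the realization given by a vertex. -/
noncomputable def vertexPoint [DecidableEq V] {K : SComplex V} {v : V} (h : {v} ∈ K) :
    realization K :=
  ⟨Pi.single v 1, single_mem_realization h⟩

theorem singleton_mem_of_mem {V : Type*} {K : SComplex V} {F : Finset V} (hF : F ∈ K) {v : V} (hv : v ∈ F) :
    {v} ∈ K :=
  K.lower (Finset.singleton_subset_iff.2 hv) hF

/-- Two points of a common face are joined by a segment. -/
theorem joined_of_common_face {K : SComplex V} {F : Finset V} (hF : F ∈ K) (p q : realization K)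
    (hp : ∀ v, v ∉ F → p.1 v = 0) (hq : ∀ v, v ∉ F → q.1 v = 0) : Joined p q := by
  refine ⟨⟨⟨fun t : I => ⟨(1 - (t : ℝ)) • p.1 + (t : ℝ) • q.1, ?_, F, hF, fun v hv => ?_⟩, ?_⟩,
    ?_, ?_⟩⟩
  · exact convex_stdSimplex ℝ V p.2.1 q.2.1 (sub_nonneg.2 t.2.2) t.2.1 (by ring)
  · simp [hp v hv, hq v hv]
  · exact Continuous.subtype_mk (by fun_prop) _
  · ext v; simp
  · ext v; simp

/-- A point of a face is joined to each vertex of the face. -/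
theorem joined_vertexPoint [DecidableEq V] {K : SComplex V} {F : Finset V} (hF : F ∈ K)
    (p : realization K) (hp : ∀ v, v ∉ F → p.1 v = 0) {v : V} (hv : v ∈ F) (h : {v} ∈ K) :
    Joined p (vertexPoint h) :=
  joined_of_common_face hF p _ hp fun u hu => by
    show (Pi.single v 1 : V → ℝ) u = 0
    rw [Pi.single_apply, if_neg]
    rintro rfl
    exact hu hv

theorem exists_pos_of_mem_realization {K : SComplex V} (p : realization K) : ∃ v, p.1 v ≠ 0 := by
  by_contra! h
  have := p.2.1.2
  simp [h] at this

/-- Every point of the realization is joined to a vertex of its carrier. -/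
theorem exists_joined_vertexPoint [DecidableEq V] {K : SComplex V} (p : realization K) :
    ∃ (v : V) (h : {v} ∈ K), Joined p (vertexPoint h) := by
  obtain ⟨F, hF, hp⟩ := p.2.2
  obtain ⟨v, hv⟩ := exists_pos_of_mem_realization p
  have hvF : v ∈ F := by
    by_contra h
    exact hv (hp v h)
  exact ⟨v, singleton_mem_of_mem hF hvF, joined_vertexPoint hF p hp hvF _⟩

/-- A point closer to `y` than the least positive coordinate `ε` of `y` has all the vertices of the
carrier of `y` in its support. The segment to `y` then stays in one face, and the contraction is
linear. -/
theorem wellPointed_realization {K : SComplex V} (y : realization K) : WellPointed y := by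
  obtain ⟨ε, hε, hy⟩ : ∃ ε : ℝ, 0 < ε ∧ ∀ v, y.1 v ≠ 0 → ε ≤ y.1 v := by
    classical
    obtain ⟨v, hv⟩ := exists_pos_of_mem_realization y
    obtain ⟨u, hu, hmin⟩ := Finset.exists_min_image (Finset.univ.filter fun v => y.1 v ≠ 0) y.1
      ⟨v, by simpa using hv⟩
    refine ⟨y.1 u, lt_of_le_of_ne (y.2.1.1 u) (Ne.symm (by simpa using hu)), fun w hw =>
      hmin w (by simpa using hw)⟩
  let d : C(realization K, I) :=
    ⟨fun q => Set.projIcc 0 1 zero_le_one (dist q.1 y.1 / ε), by fun_prop⟩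
  -- The weight kept on the moving point: 1 at time 0 and wherever `d = 1`, so that points at
  -- distance at least `ε` never move, and 0 at time 1 where `d ≤ 1/2`.
  let κ : I × realization K → ℝ := fun p => 1 - p.1 + p.1 * max 0 (2 * (d p.2 : ℝ) - 1)
  have hκ0 : ∀ p, 0 ≤ κ p := fun p => by
    have h1 := p.1.2.1
    have h2 := p.1.2.2
    have := mul_nonneg h1 (le_max_left 0 (2 * (d p.2 : ℝ) - 1))
    simp only [κ]; linarith
  have hκ1 : ∀ p, κ p ≤ 1 := fun p => by
    have h1 := p.1.2.1
    have h3 : max 0 (2 * (d p.2 : ℝ) - 1) ≤ 1 := max_le zero_le_one (by linarith [(d p.2).2.2])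
    have := mul_le_mul_of_nonneg_left h3 h1
    simp only [κ]; linarith
  have hκc : Continuous κ := by fun_prop
  let c : I × realization K → V → ℝ := fun p => (1 - κ p) • y.1 + κ p • p.2.1
  have hc : ∀ p, c p ∈ realization K := fun p => by
    refine ⟨convex_stdSimplex ℝ V y.2.1 p.2.2.1 (sub_nonneg.2 (hκ1 p)) (hκ0 p) (by ring), ?_⟩
    obtain ⟨F, hF, hFp⟩ := p.2.2.2
    refine ⟨F, hF, fun v hv => ?_⟩
    have hv0 := hFp v hv
    by_cases hd : dist p.2.1 y.1 < ε
    · have : y.1 v = 0 := by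
        by_contra h
        have h1 := hy v h
        have h2 := dist_le_pi_dist p.2.1 y.1 v
        rw [hv0, Real.dist_eq, zero_sub, abs_neg] at h2
        linarith [le_abs_self (y.1 v)]
      simp [c, this, hv0]
    · have h1 : (d p.2 : ℝ) = 1 := by
        have : d p.2 = 1 := Set.projIcc_of_right_le zero_le_one
          ((one_le_div hε).2 (not_lt.1 hd))
        rw [this]; rfl
      have : κ p = 1 := by simp only [κ, h1]; norm_num
      simp [c, this, hv0]
  refine ⟨⟨fun p => ⟨c p, hc p⟩, Continuous.subtype_mk (by fun_prop) _⟩, d, fun q => ?_,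
    fun t => ?_, ?_, fun q hq => ?_⟩
  · ext v; simp [c, κ]
  · ext v; simp only [ContinuousMap.coe_mk, c, Pi.add_apply, Pi.smul_apply, smul_eq_mul]; ring
  · simp [d]
  · have : κ (1, q) = 0 := by
      simp only [κ]
      rw [max_eq_left (by linarith)]; simp
    ext v; simp [c, this]

/-- The inclusion of the realization of a subcomplex. -/
def inclusion {K' K : SComplex V} (h : K' ≤ K) : C(realization K', realization K) :=
  ⟨fun p => ⟨p.1, p.2.1, p.2.2.imp fun _ hF => ⟨h hF.1, hF.2⟩⟩,
    Continuous.subtype_mk continuous_subtype_val _⟩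

/-! ### Injective vertex maps -/

/-- The image of a complex under an injective map of the vertices. -/
def mapComplex {V W : Type*} (f : V ↪ W) (K : SComplex V) : SComplex W where
  carrier := {F | ∃ G ∈ K, G.map f = F}
  lower' := by
    rintro _ F' hF' ⟨G, hG, rfl⟩
    obtain ⟨G', hG', rfl⟩ := Finset.subset_map_iff.1 hF'
    exact ⟨G', K.lower hG' hG, rfl⟩

@[simp] theorem map_mem_mapComplex {V W : Type*} {f : V ↪ W} {K : SComplex V} {G : Finset V} :
    G.map f ∈ mapComplex f K ↔ G ∈ K := by
  refine ⟨?_, fun h => ⟨G, h, rfl⟩⟩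
  rintro ⟨G', h, e⟩
  rwa [← Finset.map_injective f e]

theorem extend_mem_realization (f : V ↪ W) {K : SComplex V} {L : SComplex W}
    (h : mapComplex f K ≤ L) (p : realization K) : Function.extend f p.1 0 ∈ realization L := by
  obtain ⟨F, hF, hp⟩ := p.2.2
  have h0 : ∀ w, w ∉ F.map f → Function.extend f p.1 0 w = 0 := fun w hw => by
    by_cases hr : ∃ v, f v = w
    · obtain ⟨v, rfl⟩ := hr
      rw [f.injective.extend_apply]
      exact hp v fun hv => hw (Finset.mem_map_of_mem f hv)
    · rw [Function.extend_apply' _ _ _ hr]; rfl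
  refine ⟨⟨fun w => ?_, ?_⟩, F.map f, h ⟨F, hF, rfl⟩, h0⟩
  · by_cases hr : ∃ v, f v = w
    · obtain ⟨v, rfl⟩ := hr
      rw [f.injective.extend_apply]
      exact p.2.1.1 v
    · rw [Function.extend_apply' _ _ _ hr]; rfl
  · rw [← p.2.1.2]
    refine (Fintype.sum_of_injective f f.injective _ _ (fun w hw => ?_) fun v => ?_).symm
    · rw [Function.extend_apply' _ _ _ (by simpa using hw)]; rfl
    · rw [f.injective.extend_apply]

/-- The map of realizations induced by an injective vertex map. -/
noncomputable def pushforward (f : V ↪ W) {K : SComplex V} {L : SComplex W}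
    (h : mapComplex f K ≤ L) : C(realization K, realization L) :=
  ⟨fun p => ⟨Function.extend f p.1 0, extend_mem_realization f h p⟩,
    Continuous.subtype_mk (continuous_pi fun w => by
      by_cases hr : ∃ v, f v = w
      · obtain ⟨v, rfl⟩ := hr
        simp only [f.injective.extend_apply]
        exact (continuous_apply v).comp continuous_subtype_val
      · simp only [Function.extend_apply' _ _ _ hr]
        exact continuous_const) _⟩

@[simp] theorem pushforward_apply (f : V ↪ W) {K : SComplex V} {L : SComplex W}
    (h : mapComplex f K ≤ L) (p : realization K) (v : V) : (pushforward f h p).1 (f v) = p.1 v :=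
  f.injective.extend_apply _ _ _

theorem pushforward_apply_of_notMem (f : V ↪ W) {K : SComplex V} {L : SComplex W}
    (h : mapComplex f K ≤ L) (p : realization K) {w : W} (hw : ∀ v, f v ≠ w) :
    (pushforward f h p).1 w = 0 :=
  Function.extend_apply' _ _ _ (by simpa using hw)

theorem pushforward_injective (f : V ↪ W) {K : SComplex V} {L : SComplex W}
    (h : mapComplex f K ≤ L) : Function.Injective (pushforward f h) := by
  intro p q hpq
  ext v
  rw [← pushforward_apply f h p, hpq, pushforward_apply]

theorem exists_pushforward_eq (f : V ↪ W) {K : SComplex V} {L : SComplex W}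
    (h : mapComplex f K ≤ L) (q : realization L) {F : Finset V} (hF : F ∈ K)
    (hq : ∀ w, w ∉ F.map f → q.1 w = 0) : ∃ p, pushforward f h p = q := by
  have h0 : ∀ w, w ∉ Set.range f → q.1 w = 0 := fun w hw => hq w fun h => by
    obtain ⟨v, -, rfl⟩ := Finset.mem_map.1 h
    exact hw ⟨v, rfl⟩
  refine ⟨⟨q.1 ∘ f, ⟨fun v => q.2.1.1 _, ?_⟩, F, hF, fun v hv => hq _ (by simpa using hv)⟩, ?_⟩
  · rw [← q.2.1.2]
    exact Fintype.sum_of_injective f f.injective _ _ h0 fun v => rfl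
  · ext w
    by_cases hr : ∃ v, f v = w
    · obtain ⟨v, rfl⟩ := hr
      rw [pushforward_apply]; rfl
    · rw [pushforward_apply_of_notMem _ _ _ (by simpa using hr), h0 w (by simpa using hr)]

theorem pushforward_vertexPoint [DecidableEq V] [DecidableEq W] (f : V ↪ W) {K : SComplex V}
    {L : SComplex W} (h : mapComplex f K ≤ L) {v : V} (hv : {v} ∈ K) (hw : {f v} ∈ L) :
    pushforward f h (vertexPoint hv) = vertexPoint hw := by
  ext w
  by_cases hr : ∃ v, f v = w
  · obtain ⟨u, rfl⟩ := hr
    rw [pushforward_apply]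
    simp [vertexPoint, Pi.single_apply]
  · rw [pushforward_apply_of_notMem _ _ _ (by simpa using hr)]
    simp only [vertexPoint, Pi.single_apply]
    rw [if_neg]
    rintro rfl
    exact hr ⟨v, rfl⟩

/-- An injective vertex map induces a homeomorphism onto the realization of the image. -/
noncomputable def mapHomeomorph (f : V ↪ W) (K : SComplex V) :
    realization K ≃ₜ realization (mapComplex f K) :=
  Continuous.homeoOfEquivCompactToT2 (f := Equiv.ofBijective (pushforward f le_rfl)
    ⟨pushforward_injective f le_rfl, fun q => by
      obtain ⟨_, ⟨F, hF, rfl⟩, hq⟩ := q.2.2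
      exact exists_pushforward_eq f le_rfl q hF hq⟩) (pushforward f le_rfl).continuous

/-- If `f` and `g` embed the vertices of `K` and `L` so that the images meet in the common image
of the vertices `a` and `b` only, then the union of the images is the wedge sum. -/
theorem wedge_pointedEquiv {U : Type*} [Fintype U] [DecidableEq U] [DecidableEq V]
    (f : V ↪ W) (g : U ↪ W) {K : SComplex V}
    {L : SComplex U} {a : V} {b : U} (ha : {a} ∈ K) (hb : {b} ∈ L) (hab : f a = g b)
    (hfg : ∀ u v, f u = g v → u = a) (p : realization K) :
    PointedEquiv (Wedge.inl (vertexPoint ha) (vertexPoint hb) p)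
      (pushforward f (le_sup_left : mapComplex f K ≤ mapComplex f K ⊔ mapComplex g L) p) := by
  classical
  have hf : mapComplex f K ≤ mapComplex f K ⊔ mapComplex g L := le_sup_left
  have hg : mapComplex g L ≤ mapComplex f K ⊔ mapComplex g L := le_sup_right
  have hm : {f a} ∈ mapComplex f K ⊔ mapComplex g L := hf ⟨{a}, ha, by simp⟩
  have e1 : pushforward f hf (vertexPoint ha) = vertexPoint hm := pushforward_vertexPoint f hf ha hm
  have e2 : pushforward g hg (vertexPoint hb) = vertexPoint hm := by
    rw [pushforward_vertexPoint g hg hb (by rwa [← hab])]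
    ext w; simp [vertexPoint, hab]
  have key : ∀ p q, pushforward f hf p = pushforward g hg q →
      p = vertexPoint ha ∧ q = vertexPoint hb := by
    intro p q hpq
    have h0 : ∀ u, u ≠ a → p.1 u = 0 := fun u hu => by
      rw [← pushforward_apply f hf, hpq]
      exact pushforward_apply_of_notMem _ _ _ fun v hv => hu (hfg u v hv.symm)
    have h1 : p = vertexPoint ha := by
      have hs := p.2.1.2
      rw [Finset.sum_eq_single a (fun u _ hu => h0 u hu) (by simp)] at hs
      ext u
      by_cases hu : u = a
      · subst hu; simp [vertexPoint, hs]
      · simp [vertexPoint, hu, h0 u hu]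
    refine ⟨h1, pushforward_injective g hg ?_⟩
    rw [← hpq, h1, e1, e2]
  let F : Wedge (vertexPoint ha) (vertexPoint hb) →
      realization (mapComplex f K ⊔ mapComplex g L) :=
    Wedge.lift (pushforward f hf) (pushforward g hg) (e1.trans e2.symm)
  have hF : Continuous F :=
    Wedge.continuous_lift _ (pushforward f hf).continuous (pushforward g hg).continuous
  have hbij : Function.Bijective F := by
    constructor
    · refine Wedge.ind (fun p => Wedge.ind (fun q h => ?_) (fun q h => ?_))
        (fun p => Wedge.ind (fun q h => ?_) (fun q h => ?_))
      · rw [pushforward_injective f hf h]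
      · obtain ⟨rfl, rfl⟩ := key p q h
        exact Wedge.glue _ _
      · obtain ⟨rfl, rfl⟩ := key q p (Eq.symm h)
        exact (Wedge.glue _ _).symm
      · rw [pushforward_injective g hg h]
    · intro q
      obtain ⟨_, ⟨F', hF', rfl⟩ | ⟨F', hF', rfl⟩, hq⟩ := q.2.2
      · obtain ⟨p, rfl⟩ := exists_pushforward_eq f hf q hF' hq
        exact ⟨Wedge.inl _ _ p, rfl⟩
      · obtain ⟨p, rfl⟩ := exists_pushforward_eq g hg q hF' hq
        exact ⟨Wedge.inr _ _ p, rfl⟩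
  have : CompactSpace (Wedge (vertexPoint ha) (vertexPoint hb)) :=
    inferInstanceAs (CompactSpace (Quot _))
  exact PointedEquiv.of_homeomorph
    (Continuous.homeoOfEquivCompactToT2 (f := Equiv.ofBijective F hbij) hF) (Wedge.inl _ _ p)

end Realization

/-! ### Collapses -/

section Collapse

variable {V : Type*} [Fintype V] [DecidableEq V]

/-- `F` is a free face of `insert a F`. Points of that simplex are pushed away from the face `F`
towards `a` until some coordinate in `F` vanishes; all other points stay fixed. -/
theorem elementary_collapse {K K' : SComplex V} {F : Finset V} {a : V} (hF : F.Nonempty)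
    (ha : a ∉ F) (haF : insert a F ∈ K) (hK : ∀ G ∈ K, F ⊆ G → G ⊆ insert a F)
    (hK' : ∀ G, G ∈ K' ↔ G ∈ K ∧ ¬ F ⊆ G) (hle : K' ≤ K) (p : realization K') :
    PointedEquiv (inclusion hle p) p := by
  let m : (V → ℝ) → ℝ := fun p => F.inf' hF p
  have hm : Continuous m := by
    have := Continuous.finset_inf'_apply (X := V → ℝ) (s := F) hF (f := fun v p => p v)
      (fun v _ => continuous_apply v)
    exact this
  have hm0 : ∀ p ∈ realization K, 0 ≤ m p := fun p hp => Finset.le_inf' _ _ fun v _ => hp.1.1 v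
  have hmle : ∀ p : V → ℝ, ∀ v ∈ F, m p ≤ p v := fun p v hv => Finset.inf'_le _ hv
  have hmz : ∀ p ∈ realization K, ∀ v ∈ F, p v = 0 → m p = 0 := fun p hp v hv h =>
    le_antisymm (h ▸ hmle p v hv) (hm0 p hp)
  -- The direction of the push: every vertex of `F` loses one unit and `a` gains them all, so the
  -- coordinate sum is preserved. The speed is the least coordinate `m p` in `F`, which is 0 exactly
  -- off the faces being removed.
  let δ : V → ℝ := fun v => (if v = a then (F.card : ℝ) else 0) - if v ∈ F then 1 else 0
  have hδ : ∑ v, δ v = 0 := by simp [δ]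
  have hδF : ∀ v ∈ F, δ v = -1 := fun v hv => by
    have : v ≠ a := by rintro rfl; exact ha hv
    simp [δ, hv, this]
  have hδ0 : ∀ v, v ∉ F → 0 ≤ δ v := fun v hv => by
    simp only [δ, hv, if_false, sub_zero]; split_ifs <;> positivity
  have hδn : ∀ v, v ∉ insert a F → δ v = 0 := fun v hv => by
    rw [Finset.mem_insert, not_or] at hv
    simp [δ, hv.1, hv.2]
  let r : ℝ → (V → ℝ) → V → ℝ := fun t p => p + (t * m p) • δ
  have hstd : ∀ t ∈ I, ∀ p ∈ realization K, r t p ∈ stdSimplex ℝ V := by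
    intro t ht p hp
    refine ⟨fun v => ?_, ?_⟩
    · simp only [r, Pi.add_apply, Pi.smul_apply, smul_eq_mul]
      by_cases hv : v ∈ F
      · rw [hδF v hv]
        have := hmle p v hv
        have := mul_le_of_le_one_left (hm0 p hp) ht.2
        linarith
      · have := hp.1.1 v
        have := mul_nonneg (mul_nonneg ht.1 (hm0 p hp)) (hδ0 v hv)
        linarith
    · simp only [r, Pi.add_apply, Pi.smul_apply, smul_eq_mul, Finset.sum_add_distrib,
        ← Finset.mul_sum, hδ, mul_zero, add_zero]
      exact hp.1.2
  have hr : ∀ t ∈ I, ∀ p ∈ realization K, r t p ∈ realization K := by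
    intro t ht p hp
    refine ⟨hstd t ht p hp, ?_⟩
    obtain ⟨G, hG, hpG⟩ := hp.2
    by_cases hFG : F ⊆ G
    · refine ⟨insert a F, haF, fun v hv => ?_⟩
      simp [r, hδn v hv, hpG v fun h => hv (hK G hG hFG h)]
    · obtain ⟨v, hv, hvG⟩ := Finset.not_subset.1 hFG
      refine ⟨G, hG, fun u hu => ?_⟩
      simp [r, hmz p hp v hv (hpG v hvG), hpG u hu]
  have hr1 : ∀ p ∈ realization K, r 1 p ∈ realization K' := by
    intro p hp
    refine ⟨hstd 1 ⟨zero_le_one, le_rfl⟩ p hp, ?_⟩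
    obtain ⟨G, hG, hpG⟩ := hp.2
    by_cases hFG : F ⊆ G
    · obtain ⟨v, hv, hmv⟩ := Finset.exists_mem_eq_inf' hF p
      refine ⟨(insert a F).erase v, (hK' _).2 ⟨K.lower (Finset.erase_subset _ _) haF, fun h =>
        Finset.notMem_erase _ _ (h hv)⟩, fun u hu => ?_⟩
      by_cases huv : u = v
      · subst huv
        have : m p = p u := hmv
        simp [r, this, hδF u hv]
      · have hu' : u ∉ insert a F := fun h => hu (Finset.mem_erase.2 ⟨huv, h⟩)
        simp [r, hδn u hu', hpG u fun h => hu' (hK G hG hFG h)]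
    · obtain ⟨v, hv, hvG⟩ := Finset.not_subset.1 hFG
      refine ⟨G, (hK' G).2 ⟨hG, hFG⟩, fun u hu => ?_⟩
      simp [r, hmz p hp v hv (hpG v hvG), hpG u hu]
  have hfix : ∀ t, ∀ p ∈ realization K', r t p = p := by
    intro t p hp
    obtain ⟨G, hG, hpG⟩ := hp.2
    obtain ⟨v, hv, hvG⟩ := Finset.not_subset.1 ((hK' G).1 hG).2
    have : m p = 0 := hmz p (inclusion hle ⟨p, hp⟩).2 v hv (hpG v hvG)
    simp [r, this]
  have hcont : Continuous fun q : ℝ × (V → ℝ) => r q.1 q.2 := by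
    have : Continuous fun q : ℝ × (V → ℝ) => m q.2 := hm.comp continuous_snd
    simp only [r]
    fun_prop
  refine ⟨⟨fun p => ⟨r 1 p.1, hr1 p.1 p.2⟩, Continuous.subtype_mk
    (hcont.comp (f := fun p : realization K => ((1 : ℝ), p.1)) (by fun_prop)) _⟩, inclusion hle,
    ?_, rfl, ?_, ?_⟩
  · ext1; exact hfix 1 p.1 p.2
  · refine ContinuousMap.HomotopicRel.symm (homotopicRel_of_continuous
      (fun q => ⟨r q.1 q.2.1, hr q.1 q.1.2 q.2.1 q.2.2⟩) ?_ ?_ ?_ ?_)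
    · exact Continuous.subtype_mk
        (hcont.comp (f := fun q : I × realization K => ((q.1 : ℝ), q.2.1)) (by fun_prop)) _
    · intro q; ext1; simp [r]
    · intro q; ext1; rfl
    · rintro t _ rfl; ext1; exact hfix t p.1 p.2
  · have : ContinuousMap.comp (⟨fun p => ⟨r 1 p.1, hr1 p.1 p.2⟩, Continuous.subtype_mk
        (hcont.comp (f := fun p : realization K => ((1 : ℝ), p.1)) (by fun_prop)) _⟩ :
        C(realization K, realization K')) (inclusion hle) = .id _ := by
      ext q v
      exact congrFun (hfix 1 q.1 q.2) v
    rw [this]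
    exact .refl _

/-- If the faces of `K` outside `K'` are matched by inserting and removing the vertex `a`, then
`K` and `K'` are homotopy equivalent relative to `K'`. -/
theorem collapse {K K' : SComplex V} (hle : K' ≤ K) (h0 : ∅ ∈ K') (a : V)
    (h1 : ∀ F ∈ K, F ∉ K' → insert a F ∈ K) (h2 : ∀ F ∈ K, F ∉ K' → F.erase a ∉ K')
    (p : realization K') : PointedEquiv (inclusion hle p) p := by
  classical
  obtain ⟨n, hn⟩ : ∃ n, (Finset.univ.filter fun F => F ∈ K ∧ F ∉ K').card = n := ⟨_, rfl⟩
  induction n using Nat.strong_induction_on generalizing K with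
  | _ n ih =>
    rcases (Finset.univ.filter fun F => F ∈ K ∧ F ∉ K').eq_empty_or_nonempty with he | hne
    · have : K = K' := by
        refine le_antisymm (fun F hF => ?_) hle
        by_contra hF'
        have : F ∈ (Finset.univ.filter fun F => F ∈ K ∧ F ∉ K') := by
          simp only [Finset.mem_filter, Finset.mem_univ, true_and]
          exact ⟨hF, hF'⟩
        rw [he] at this
        simp at this
      subst this
      exact PointedEquiv.refl p
    -- A largest face outside `K'` contains `a`, and by maximality it is the only face of `K`
    -- properly containing `F.erase a`. So this pair is an elementary collapse, and the matching
    -- survives its removal.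
    · obtain ⟨F, hF, hmax⟩ := Finset.exists_max_image _ Finset.card hne
      simp only [Finset.mem_filter, Finset.mem_univ, true_and, and_imp] at hF hmax
      have hup : ∀ G ∈ K, G ∉ K' → insert a G ∈ K ∧ insert a G ∉ K' := fun G hG hG' =>
        ⟨h1 G hG hG', fun h => hG' (K'.lower (Finset.subset_insert a G) h)⟩
      have haF : a ∈ F := by
        by_contra haF
        have := hmax _ (hup F hF.1 hF.2).1 (hup F hF.1 hF.2).2
        rw [Finset.card_insert_of_notMem haF] at this
        omega
      have hF0' := h2 F hF.1 hF.2
      have hF0 : (F.erase a).Nonempty := by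
        rw [Finset.nonempty_iff_ne_empty]
        intro h
        exact hF0' (h ▸ h0)
      let K₁ : SComplex V :=
        { carrier := {G | G ∈ K ∧ ¬ F.erase a ⊆ G}
          lower' := fun G G' h hG => ⟨K.lower h hG.1, fun h' => hG.2 (h'.trans h)⟩ }
      have hK₁ : K₁ ≤ K := fun G hG => hG.1
      have hle₁ : K' ≤ K₁ := fun G hG => ⟨hle hG, fun h => hF0' (K'.lower h hG)⟩
      have hstep := elementary_collapse (K := K) (K' := K₁) hF0 (Finset.notMem_erase a F)
        (by rw [Finset.insert_erase haF]; exact hF.1) (fun G hG hFG => by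
          have hG' : G ∉ K' := fun h => hF0' (K'.lower hFG h)
          have hc := hmax _ (hup G hG hG').1 (hup G hG hG').2
          have hs : F ⊆ insert a G := by
            rw [← Finset.insert_erase haF]
            exact Finset.insert_subset_insert a hFG
          rw [Finset.insert_erase haF, Finset.eq_of_subset_of_card_le hs hc]
          exact Finset.subset_insert a G) (fun G => Iff.rfl) hK₁ (inclusion hle₁ p)
      refine hstep.trans (ih _ ?_ hle₁ (fun G hG hG' => ⟨h1 G hG.1 hG', fun h => hG.2 ?_⟩)
        (fun G hG hG' => h2 G hG.1 hG') rfl)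
      · rw [← hn]
        refine Finset.card_lt_card (Finset.ssubset_iff_of_subset ?_ |>.2 ⟨F, ?_, ?_⟩)
        · intro G
          simp only [Finset.mem_filter, Finset.mem_univ, true_and]
          exact fun h => ⟨h.1.1, h.2⟩
        · simpa using hF
        · simp only [Finset.mem_filter, Finset.mem_univ, true_and]
          exact fun h => h.1.2 (Finset.erase_subset a F)
      · intro v hv
        rcases Finset.mem_insert.1 (h hv) with rfl | h
        · exact absurd hv (Finset.notMem_erase _ _)
        · exact h

end Collapse

/-! ### Attaching a cone along a contractible subcomplex -/

/-- For a collapse in which the matching vertex varies: the indices are treated one after the other,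
index `i` using the vertex `c i`. -/
theorem collapse_finset {W ι : Type*} [Fintype W] [DecidableEq W] [DecidableEq ι]
    (K : Finset ι → SComplex W) (c : ι → W) {N K' : SComplex W} {S : Finset ι}
    (hN : K ∅ = N) (hS : K S = K') (h0 : ∀ S, ∅ ∈ K S)
    (hle : ∀ S i, K (insert i S) ≤ K S)
    (h1 : ∀ S i, ∀ F ∈ K S, F ∉ K (insert i S) → insert (c i) F ∈ K S)
    (h2 : ∀ S i, ∀ F ∈ K S, F ∉ K (insert i S) → F.erase (c i) ∉ K (insert i S))
    (h : K' ≤ N) (p : realization K') : PointedEquiv (inclusion h p) p := by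
  subst hN hS
  induction S using Finset.induction_on with
  | empty => exact PointedEquiv.refl p
  | insert i S _ ih =>
    have hK : ∀ S, K S ≤ K ∅ := fun S => by
      induction S using Finset.induction_on with
      | empty => exact le_rfl
      | insert j S _ ih => exact (hle S j).trans ih
    exact (ih (inclusion (hle S i) p) (hK S)).trans
      (collapse (hle S i) (h0 _) (c i) (h1 S i) (h2 S i) p)

section ConeAttach

variable {V : Type*}

/-- The union of `X` with the cone over `L`; the apex is the vertex `none`. -/
def coneAttach (X L : SComplex V) : SComplex (Option V) where
  carrier := {F | F.eraseNone ∈ X ∧ (none ∈ F → F.eraseNone ∈ L)}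
  lower' := fun _ _ h hF => ⟨X.lower (Finset.eraseNone.monotone h) hF.1,
    fun hn => L.lower (Finset.eraseNone.monotone h) (hF.2 (h hn))⟩

theorem mem_coneAttach {X L : SComplex V} {F : Finset (Option V)} :
    F ∈ coneAttach X L ↔ F.eraseNone ∈ X ∧ (none ∈ F → F.eraseNone ∈ L) := Iff.rfl

theorem mapComplex_some_le_coneAttach (X L : SComplex V) :
    mapComplex Function.Embedding.some X ≤ coneAttach X L := by
  rintro _ ⟨F, hF, rfl⟩
  have : (F.map Function.Embedding.some).eraseNone = F := by ext; simp
  exact ⟨by rwa [this], by simp⟩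

theorem mem_suspension {L : SComplex V} {F : Finset (V ⊕ Bool)} :
    F ∈ suspension L ↔ F.toLeft ∈ L ∧ F.toRight.card ≤ 1 := Iff.rfl

theorem pole_mem_suspension {L : SComplex V} (hL : ∅ ∈ L) (β : Bool) :
    {Sum.inr β} ∈ suspension L := by
  refine ⟨?_, ?_⟩
  · convert hL
    ext; simp
  · show Finset.card _ ≤ 1
    have : (({Sum.inr β} : Finset (V ⊕ Bool))).toRight = {β} := by ext; simp
    simp [this]

variable [DecidableEq V]

/-- The vertices of a set in `Option V ⊕ V` that lie in the first copy of `V`. -/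
def firstPart {V : Type*} (H : Finset (Option V ⊕ V)) : Finset V := H.toLeft.eraseNone

@[simp] theorem mem_firstPart {V : Type*} {H : Finset (Option V ⊕ V)} {v : V} :
    v ∈ firstPart H ↔ Sum.inl (some v) ∈ H := by simp [firstPart]

theorem firstPart_mono {V : Type*} {H H' : Finset (Option V ⊕ V)} (h : H ⊆ H') :
    firstPart H ⊆ firstPart H' := fun v hv => by
  rw [mem_firstPart] at *
  exact h hv

/-- The mapping cylinder of the inclusion of `L`, with a cone over the cylinder of apex `none` and
a cone over the free end of apex `a`. -/
def doubleCylinder (X L : SComplex V) (a : V) : SComplex (Option V ⊕ V) where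
  carrier := {H | (Sum.inl none ∉ H →
      (H.toRight = ∅ ∧ firstPart H ∈ X) ∨ (firstPart H).erase a ∪ H.toRight ∈ L) ∧
    (Sum.inl none ∈ H → firstPart H ∪ H.toRight ∈ L)}
  lower' := by
    intro H H' h hH
    have hl := firstPart_mono h
    have hr := Finset.toRight_monotone h
    refine ⟨fun hn' => ?_, fun hn' => L.lower (Finset.union_subset_union hl hr) (hH.2 (h hn'))⟩
    by_cases hn : Sum.inl none ∈ H
    · exact Or.inr (L.lower (Finset.union_subset_union
        ((Finset.erase_subset _ _).trans hl) hr) (hH.2 hn))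
    · rcases hH.1 hn with ⟨h1, h2⟩ | h1
      · exact Or.inl ⟨Finset.subset_empty.1 (h1 ▸ hr), X.lower hl h2⟩
      · exact Or.inr (L.lower (Finset.union_subset_union (Finset.erase_subset_erase a hl) hr) h1)

theorem mem_doubleCylinder {X L : SComplex V} {a : V} {H : Finset (Option V ⊕ V)} :
    H ∈ doubleCylinder X L a ↔ (Sum.inl none ∉ H →
      (H.toRight = ∅ ∧ firstPart H ∈ X) ∨ (firstPart H).erase a ∪ H.toRight ∈ L) ∧
    (Sum.inl none ∈ H → firstPart H ∪ H.toRight ∈ L) := Iff.rfl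

/-- The subcomplex of the faces with a property that is inherited by subsets. -/
def subcomplex {W : Type*} (K : SComplex W) (P : Finset W → Prop)
    (hP : ∀ F F', F' ⊆ F → P F → P F') : SComplex W where
  carrier := {F | F ∈ K ∧ P F}
  lower' := fun F F' h hF => ⟨K.lower h hF.1, hP F F' h hF.2⟩

variable {X L : SComplex V} {a : V}

theorem empty_mem_doubleCylinder (hL : ∅ ∈ L) : ∅ ∈ doubleCylinder X L a := by
  refine ⟨fun _ => Or.inr ?_, by simp⟩
  convert hL
  ext; simp

theorem mem_mapComplex_inl_coneAttach {V : Type*} {X L : SComplex V} {H : Finset (Option V ⊕ V)} :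
    H ∈ mapComplex Function.Embedding.inl (coneAttach X L) ↔
      H.toRight = ∅ ∧ firstPart H ∈ X ∧ (Sum.inl none ∈ H → firstPart H ∈ L) := by
  constructor
  · rintro ⟨F, hF, rfl⟩
    have : firstPart (F.map Function.Embedding.inl : Finset (Option V ⊕ V)) = F.eraseNone := by
      ext; simp
    rw [this]
    refine ⟨by ext; simp, hF.1, fun h => hF.2 ?_⟩
    simpa using h
  · rintro ⟨h0, h1, h2⟩
    refine ⟨H.toLeft, ⟨h1, fun h => h2 (by simpa using h)⟩, ?_⟩
    ext (v | v)
    · simp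
    · have : v ∉ H.toRight := by simp [h0]
      simpa using this

theorem coneAttach_le_doubleCylinder :
    mapComplex Function.Embedding.inl (coneAttach X L) ≤ doubleCylinder X L a := by
  intro H hH
  obtain ⟨h0, h1, h2⟩ := mem_mapComplex_inl_coneAttach.1 hH
  exact ⟨fun _ => Or.inl ⟨h0, h1⟩, fun h => by rw [h0, Finset.union_empty]; exact h2 h⟩

variable [Fintype V]

/-- Pushes the cylinder onto its attached end. Faces containing the second copy of `v` are matched
by the first copy of `v`; by `hQ` the cone of apex `a` that remains already lies in `X`. -/
theorem doubleCylinder_equiv_coneAttach (hL : ∅ ∈ L) (hQ : ∀ F, F.erase a ∈ L → F ∈ X)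
    (p : realization (mapComplex Function.Embedding.inl (coneAttach X L))) :
    PointedEquiv (inclusion (coneAttach_le_doubleCylinder (a := a)) p) p := by
  let K : Finset V → SComplex (Option V ⊕ V) := fun S =>
    subcomplex (doubleCylinder X L a) (fun H => ∀ v ∈ S, Sum.inr v ∉ H)
      fun F F' h hF v hv hv' => hF v hv (h hv')
  have hout : ∀ (S : Finset V) i, ∀ F ∈ K S, F ∉ K (insert i S) → Sum.inr i ∈ F := by
    intro S i F hF hF'
    by_contra hi
    exact hF' ⟨hF.1, fun v hv => by
      rcases Finset.mem_insert.1 hv with rfl | hv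
      · exact hi
      · exact hF.2 v hv⟩
  refine collapse_finset K (fun v => Sum.inl (some v)) (S := Finset.univ) ?_ ?_ ?_ ?_ ?_ ?_ _ p
  · ext H
    exact ⟨fun h => h.1, fun h => ⟨h, by simp⟩⟩
  · ext H
    refine Iff.trans ?_ mem_mapComplex_inl_coneAttach.symm
    constructor
    · rintro ⟨h1, h2⟩
      have h0 : H.toRight = ∅ := by
        ext v; simpa using h2 v (Finset.mem_univ v)
      rw [mem_doubleCylinder, h0, Finset.union_empty, Finset.union_empty] at h1
      refine ⟨h0, ?_, h1.2⟩
      by_cases hn : Sum.inl none ∈ H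
      · exact hQ _ (L.lower (Finset.erase_subset _ _) (h1.2 hn))
      · rcases h1.1 hn with h | h
        · exact h.2
        · exact hQ _ h
    · intro h
      refine ⟨coneAttach_le_doubleCylinder (mem_mapComplex_inl_coneAttach.2 h), fun v _ hv => ?_⟩
      have : v ∈ H.toRight := by simpa using hv
      simp [h.1] at this
  · exact fun S => ⟨empty_mem_doubleCylinder hL, by simp⟩
  · exact fun S i H hH => ⟨hH.1, fun v hv => hH.2 v (Finset.mem_insert_of_mem hv)⟩
  · intro S i H hH hH'
    have hi := hout S i H hH hH'
    have hi' : i ∈ H.toRight := by simpa using hi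
    have hr : (insert (Sum.inl (some i)) H).toRight = H.toRight := by simp
    have hl : firstPart (insert (Sum.inl (some i)) H) = insert i (firstPart H) := by
      ext v; simp
    refine ⟨⟨fun hn => Or.inr ?_, fun hn => ?_⟩, fun v hv => ?_⟩
    · rcases hH.1.1 (by simpa using hn) with h | h
      · rw [h.1] at hi'
        simp at hi'
      · rw [hr, hl]
        refine L.lower (fun v hv => ?_) h
        simp only [Finset.mem_union, Finset.mem_erase, Finset.mem_insert] at hv ⊢
        rcases hv with ⟨h1, rfl | h2⟩ | h3
        · exact Or.inr hi'
        · exact Or.inl ⟨h1, h2⟩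
        · exact Or.inr h3
    · rw [hr, hl]
      refine L.lower (fun v hv => ?_) (hH.1.2 (by simpa using hn))
      simp only [Finset.mem_union, Finset.mem_insert] at hv ⊢
      rcases hv with (rfl | h2) | h3
      · exact Or.inr hi'
      · exact Or.inl h2
      · exact Or.inr h3
    · simpa using hH.2 v hv
  · intro S i H hH hH' h
    have hi := hout S i H hH hH'
    exact h.2 i (Finset.mem_insert_self _ _) (by simpa using hi)

/-- The faces of the double cylinder in which the apex `none` is joined to the free end only. -/
def freeEnd (X L : SComplex V) (a : V) : SComplex (Option V ⊕ V) :=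
  subcomplex (doubleCylinder X L a) (fun H => Sum.inl none ∈ H → firstPart H = ∅)
    fun _ _ h hF hn => Finset.subset_empty.1 (hF (h hn) ▸ firstPart_mono h)

/-- Pushes the cone of apex `none` towards the free end: faces containing the apex and the first
copy of `v` are matched by the second copy of `v`. -/
theorem doubleCylinder_equiv_freeEnd (hL : ∅ ∈ L) (h : freeEnd X L a ≤ doubleCylinder X L a)
    (p : realization (freeEnd X L a)) : PointedEquiv (inclusion h p) p := by
  let K : Finset V → SComplex (Option V ⊕ V) := fun S =>
    subcomplex (doubleCylinder X L a) (fun H => Sum.inl none ∈ H → ∀ v ∈ S, v ∉ firstPart H)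
      fun F F' h hF hn v hv hv' => hF (h hn) v hv (firstPart_mono h hv')
  have hout : ∀ (S : Finset V) i, ∀ F ∈ K S, F ∉ K (insert i S) →
      Sum.inl none ∈ F ∧ i ∈ firstPart F := by
    intro S i F hF hF'
    by_contra! hi
    exact hF' ⟨hF.1, fun hn v hv => by
      rcases Finset.mem_insert.1 hv with rfl | hv
      · exact hi hn
      · exact hF.2 hn v hv⟩
  refine collapse_finset K Sum.inr (S := Finset.univ) ?_ ?_ ?_ ?_ ?_ ?_ _ p
  · ext H
    exact ⟨fun h => h.1, fun h => ⟨h, by simp⟩⟩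
  · ext H
    refine and_congr Iff.rfl (imp_congr Iff.rfl ?_)
    rw [Finset.eq_empty_iff_forall_notMem]
    simp
  · exact fun S => ⟨empty_mem_doubleCylinder hL, by simp⟩
  · exact fun S i H hH => ⟨hH.1, fun hn v hv => hH.2 hn v (Finset.mem_insert_of_mem hv)⟩
  · intro S i H hH hH'
    obtain ⟨hn, hi⟩ := hout S i H hH hH'
    have hr : (insert (Sum.inr i) H).toRight = insert i H.toRight := by simp
    have hl : firstPart (insert (Sum.inr i) H) = firstPart H := by
      ext v; simp
    refine ⟨⟨fun hn' => absurd (Finset.mem_insert_of_mem hn) hn', fun _ => ?_⟩, fun _ v hv => ?_⟩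
    · rw [hr, hl]
      refine L.lower (fun v hv => ?_) (hH.1.2 hn)
      rw [Finset.mem_union, Finset.mem_insert] at hv
      rw [Finset.mem_union]
      rcases hv with h2 | rfl | h3
      · exact Or.inl h2
      · exact Or.inl hi
      · exact Or.inr h3
    · rw [hl]
      exact hH.2 hn v hv
  · intro S i H hH hH' h
    obtain ⟨hn, hi⟩ := hout S i H hH hH'
    refine h.2 (by simpa using hn) i (Finset.mem_insert_self _ _) ?_
    simpa using hi

/-- The embedding of the vertices of `X` in those of the double cylinder. -/
def firstEmbedding (V : Type*) : V ↪ Option V ⊕ V :=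
  Function.Embedding.some.trans Function.Embedding.inl

/-- The embedding of the vertices of the suspension in those of the double cylinder: the pole `β`
goes to the vertex `a`, the other one to the apex. -/
def suspensionEmbedding (a : V) (β : Bool) : V ⊕ Bool ↪ Option V ⊕ V where
  toFun := Sum.elim Sum.inr fun b => Sum.inl (if b = β then some a else none)
  inj' := by
    rintro (u | b) (v | c) h
    · simpa using h
    · simp at h
    · simp at h
    · by_cases hb : b = β <;> by_cases hc : c = β <;> simp [hb, hc] at h ⊢
      cases b <;> cases c <;> cases β <;> simp_all

@[simp] theorem firstEmbedding_apply {V : Type*} (v : V) :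
    firstEmbedding V v = Sum.inl (some v) := rfl

@[simp] theorem suspensionEmbedding_inl {V : Type*} (a : V) (β : Bool) (v : V) :
    suspensionEmbedding a β (Sum.inl v) = Sum.inr v := rfl

@[simp] theorem suspensionEmbedding_inr {V : Type*} (a : V) (β b : Bool) :
    suspensionEmbedding a β (Sum.inr b) = Sum.inl (if b = β then some a else none) := rfl

/-- The wedge sum of `X` and the suspension of `L`, as a subcomplex of the double cylinder. -/
def wedgeComplex (X L : SComplex V) (a : V) (β : Bool) : SComplex (Option V ⊕ V) :=
  mapComplex (firstEmbedding V) X ⊔ mapComplex (suspensionEmbedding a β) (suspension L)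

theorem mem_wedgeComplex {V : Type*} [DecidableEq V] {X L : SComplex V} {a : V}
    (hQ : ∀ F, F.erase a ∈ L → F ∈ X) {β : Bool}
    {H : Finset (Option V ⊕ V)} : H ∈ wedgeComplex X L a β ↔
      H ∈ freeEnd X L a ∧ (H.toRight = ∅ ∨ firstPart H ⊆ {a}) := by
  constructor
  · rintro (⟨F, hF, rfl⟩ | ⟨G, hG, rfl⟩)
    · have h0 : (F.map (firstEmbedding V)).toRight = ∅ := by
        ext; simp
      have h1 : Sum.inl none ∉ F.map (firstEmbedding V) := by simp
      have h2 : firstPart (F.map (firstEmbedding V)) = F := by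
        ext; simp
      refine ⟨⟨⟨fun _ => Or.inl ⟨h0, ?_⟩, fun h => absurd h h1⟩, fun h => absurd h h1⟩, Or.inl h0⟩
      rwa [h2]
    · have h0 : (G.map (suspensionEmbedding a β)).toRight = G.toLeft := by
        ext; simp
      have h1 : firstPart (G.map (suspensionEmbedding a β)) ⊆ {a} := by
        intro v
        simp only [mem_firstPart, Finset.mem_map, Finset.mem_singleton]
        rintro ⟨u | b, -, h⟩
        · simp at h
        · by_cases hb : b = β <;> simp [hb] at h
          exact h.symm
      have h2 : Sum.inl none ∈ G.map (suspensionEmbedding a β) →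
          firstPart (G.map (suspensionEmbedding a β)) = ∅ := by
        simp only [Finset.mem_map]
        rintro ⟨u | b, hb, h⟩
        · simp at h
        · have hbβ : b ≠ β := by rintro rfl; simp at h
          rw [Finset.eq_empty_iff_forall_notMem]
          intro v
          simp only [mem_firstPart, Finset.mem_map]
          rintro ⟨u | c, hc, h'⟩
          · simp at h'
          · have hcβ : c = β := by by_contra hcβ; simp [hcβ] at h'
            refine hbβ ((Finset.card_le_one.1 hG.2 b ?_ c ?_).trans hcβ) <;> simpa
      have h3 : (firstPart (G.map (suspensionEmbedding a β))).erase a = ∅ := by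
        rw [Finset.erase_eq_empty_iff, ← Finset.subset_singleton_iff]
        exact h1
      refine ⟨⟨⟨fun _ => Or.inr ?_, fun hn => ?_⟩, h2⟩, Or.inr h1⟩
      · rw [h3, h0, Finset.empty_union]
        exact hG.1
      · rw [h2 hn, h0, Finset.empty_union]
        exact hG.1
  · rintro ⟨⟨⟨h1, h2⟩, h3⟩, h4⟩
    by_cases hA : H.toRight = ∅ ∧ Sum.inl none ∉ H
    · refine Or.inl ⟨firstPart H, ?_, ?_⟩
      · rcases h1 hA.2 with h | h
        · exact h.2
        · rw [hA.1, Finset.union_empty] at h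
          exact hQ _ h
      · ext (_ | v) <;> simp only [Finset.mem_map, mem_firstPart, firstEmbedding_apply]
        · rename_i o
          cases o with
          | none => simp [hA.2]
          | some v => simp
        · have : v ∉ H.toRight := by simp [hA.1]
          simpa using this
    · have ha : firstPart H ⊆ {a} := by
        by_cases hn : Sum.inl none ∈ H
        · rw [h3 hn]; simp
        · rcases h4 with h4 | h4
          · exact absurd ⟨h4, hn⟩ hA
          · exact h4
      have hr : H.toRight ∈ L := by
        by_cases hn : Sum.inl none ∈ H
        · exact L.lower Finset.subset_union_right (h2 hn)
        · rcases h1 hn with h | h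
          · exact absurd ⟨h.1, hn⟩ hA
          · exact L.lower Finset.subset_union_right h
      let B : Finset Bool := Finset.univ.filter fun b => suspensionEmbedding a β (Sum.inr b) ∈ H
      have hB : ∀ b, b ∈ B ↔ Sum.inl (if b = β then some a else none) ∈ H := fun b =>
        Finset.mem_filter.trans (by simp)
      refine Or.inr ⟨H.toRight.disjSum B, ⟨by simpa using hr, ?_⟩, ?_⟩
      · show Finset.card _ ≤ 1
        rw [Finset.toRight_disjSum, Finset.card_le_one]
        have key : ∀ b ∈ B, ∀ c ∈ B, b = β → c = β := by
          intro b hb c hc hbβ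
          by_contra hcβ
          rw [hB, if_pos hbβ] at hb
          rw [hB, if_neg hcβ] at hc
          have := h3 hc
          rw [Finset.eq_empty_iff_forall_notMem] at this
          exact this a (by simpa using hb)
        intro b hb c hc
        by_cases hbβ : b = β
        · rw [hbβ, key b hb c hc hbβ]
        · have hcβ : c ≠ β := fun h => hbβ (key c hc b hb h)
          cases b <;> cases c <;> cases β <;> simp_all
      · ext (_ | v) <;> simp only [Finset.mem_map]
        · rename_i o
          constructor
          · rintro ⟨u | b, hb, h⟩
            · simp at h
            · rw [← h]
              simpa [hB] using hb
          · intro ho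
            cases o with
            | none => exact ⟨Sum.inr (!β), by simpa [hB] using ho, by simp⟩
            | some v =>
              have : v = a := by simpa using ha (mem_firstPart.2 ho)
              subst this
              exact ⟨Sum.inr β, by simpa [hB] using ho, by simp⟩
        · constructor
          · rintro ⟨u | b, hb, h⟩
            · rw [← h]
              simpa using hb
            · simp at h
          · intro hv
            exact ⟨Sum.inl v, by simpa using hv, by simp⟩

/-- The interior of the cylinder is now joined only to `a`, so inserting and removing `a` matches
its faces. There remain `X` and the suspension of the free end with poles `a` and `none`, which meet
in `a` alone. -/
theorem freeEnd_equiv_wedgeComplex (hL : ∅ ∈ L) (hQ : ∀ F, F.erase a ∈ L → F ∈ X) (β : Bool)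
    (h : wedgeComplex X L a β ≤ freeEnd X L a) (p : realization (wedgeComplex X L a β)) :
    PointedEquiv (inclusion h p) p := by
  have hout : ∀ H ∈ freeEnd X L a, H ∉ wedgeComplex X L a β →
      H.toRight ≠ ∅ ∧ ¬ firstPart H ⊆ {a} ∧ Sum.inl none ∉ H := by
    intro H hH hH'
    rw [mem_wedgeComplex hQ] at hH'
    push Not at hH'
    refine ⟨Finset.nonempty_iff_ne_empty.1 (hH' hH).1, (hH' hH).2, fun hn => (hH' hH).2 ?_⟩
    rw [hH.2 hn]
    simp
  refine collapse h ?_ (Sum.inl (some a)) ?_ ?_ p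
  · rw [mem_wedgeComplex hQ]
    refine ⟨⟨empty_mem_doubleCylinder hL, by simp⟩, Or.inl (by ext; simp)⟩
  · intro H hH hH'
    obtain ⟨h1, h2, h3⟩ := hout H hH hH'
    refine ⟨⟨fun _ => Or.inr ?_, fun hn => absurd ?_ h3⟩, fun hn => absurd ?_ h3⟩
    · rcases hH.1.1 h3 with h | h
      · exact absurd h.1 h1
      · convert h using 2
        · ext v
          simp only [Finset.mem_erase, mem_firstPart, Finset.mem_insert, Sum.inl.injEq,
            Option.some.injEq]
          tauto
        · simp
    · simpa using hn
    · simpa using hn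
  · intro H hH hH' h
    obtain ⟨h1, h2, h3⟩ := hout H hH hH'
    rcases ((mem_wedgeComplex hQ).1 h).2 with h4 | h4
    · refine h1 ?_
      rw [← h4]
      ext v; simp
    · refine h2 fun v hv => ?_
      by_cases hva : v = a
      · simp [hva]
      · exact h4 (by simpa [hva] using hv)

/-- If the cone over `L` with apex `a` lies in `X`, then attaching to `X` a cone over `L` gives
the wedge sum of `X` and the suspension of `L`. -/
theorem coneAttach_equiv_wedge (hL : ∅ ∈ L) (hQ : ∀ F, F.erase a ∈ L → F ∈ X) (β : Bool)
    (ha : {a} ∈ X) (hβ : {Sum.inr β} ∈ suspension L) (p : realization X) :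
    PointedEquiv (pushforward _ (mapComplex_some_le_coneAttach X L) p)
      (Wedge.inl (vertexPoint ha) (vertexPoint hβ) p) := by
  have h1 := PointedEquiv.of_homeomorph
    (mapHomeomorph (Function.Embedding.inl : Option V ↪ Option V ⊕ V) (coneAttach X L))
    (pushforward _ (mapComplex_some_le_coneAttach X L) p)
  have h2 := doubleCylinder_equiv_coneAttach hL hQ (mapHomeomorph
    (Function.Embedding.inl : Option V ↪ Option V ⊕ V) (coneAttach X L)
      (pushforward _ (mapComplex_some_le_coneAttach X L) p))
  have hw : wedgeComplex X L a β ≤ freeEnd X L a := fun H hH => ((mem_wedgeComplex hQ).1 hH).1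
  have hf : freeEnd X L a ≤ doubleCylinder X L a := fun H hH => hH.1
  have h5 := wedge_pointedEquiv (firstEmbedding V) (suspensionEmbedding a β) ha hβ
    (by simp) (by
      rintro u (v | b) h
      · simp at h
      · by_cases hb : b = β <;> simp [hb] at h
        exact h) p
  have h4 := freeEnd_equiv_wedgeComplex hL hQ β hw
    (pushforward (firstEmbedding V) (le_sup_left : _ ≤ wedgeComplex X L a β) p)
  have h3 := doubleCylinder_equiv_freeEnd hL hf (inclusion hw
    (pushforward (firstEmbedding V) (le_sup_left : _ ≤ wedgeComplex X L a β) p))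
  -- The two routes from `X` into the double cylinder agree on `p`, so the collapses chain as
  -- pointed equivalences.
  have e : inclusion coneAttach_le_doubleCylinder (mapHomeomorph
      (Function.Embedding.inl : Option V ↪ Option V ⊕ V) (coneAttach X L)
        (pushforward _ (mapComplex_some_le_coneAttach X L) p)) =
      inclusion hf (inclusion hw
        (pushforward (firstEmbedding V) (le_sup_left : _ ≤ wedgeComplex X L a β) p)) := by
    ext w
    show Function.extend Sum.inl (Function.extend some p.1 0) 0 w =
      Function.extend (firstEmbedding V) p.1 0 w
    rcases w with (_ | v) | v
    · rw [Sum.inl_injective.extend_apply, Function.extend_apply' _ _ _ (by simp),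
        Function.extend_apply' _ _ _ (by simp)]
      rfl
    · rw [Sum.inl_injective.extend_apply, (Option.some_injective V).extend_apply]
      exact ((firstEmbedding V).injective.extend_apply p.1 0 v).symm
    · rw [Function.extend_apply' _ _ _ (by simp),
        Function.extend_apply' _ _ _ (by simp)]
  rw [e] at h2
  exact h1.trans (h2.symm.trans (h3.trans (h4.trans h5.symm)))

end ConeAttach

/-! ### Suspensions and cones -/

section Suspension

theorem empty_mem_suspension {V : Type*} {L : SComplex V} (hL : ∅ ∈ L) : ∅ ∈ suspension L := by
  refine ⟨?_, ?_⟩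
  · convert hL
    ext; simp
  · show Finset.card _ ≤ 1
    have : (∅ : Finset (V ⊕ Bool)).toRight = ∅ := by ext; simp
    simp [this]

theorem mapComplex_eq_of_forall {V W : Type*} {f : V ↪ W} {K : SComplex V} {K' : SComplex W}
    (h : ∀ G : Finset V, G.map f ∈ K' ↔ G ∈ K) (h' : ∀ F ∈ K', ∀ w ∈ F, ∃ v, f v = w) :
    mapComplex f K = K' := by
  classical
  ext F
  constructor
  · rintro ⟨G, hG, rfl⟩
    exact (h G).2 hG
  · intro hF
    have hF' : (F : Set W) ⊆ f '' Set.univ := fun w hw => by simpa using h' F hF w hw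
    obtain ⟨G, -, rfl⟩ := Finset.subset_set_image_iff.1 hF'
    rw [← Finset.map_eq_image] at hF ⊢
    exact ⟨G, (h G).1 hF, rfl⟩

theorem mapComplex_suspension {V W : Type*} (f : V ↪ W) (K : SComplex V) :
    mapComplex (f.sumMap (Function.Embedding.refl Bool)) (suspension K) =
      suspension (mapComplex f K) := by
  refine mapComplex_eq_of_forall (fun F => ?_) ?_
  · have hl : (F.map (f.sumMap (Function.Embedding.refl Bool))).toLeft = F.toLeft.map f := by
      ext; simp
    have hr : (F.map (f.sumMap (Function.Embedding.refl Bool))).toRight = F.toRight := by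
      ext; simp
    rw [mem_suspension, mem_suspension, hl, hr, map_mem_mapComplex]
  · rintro H ⟨⟨F, hF, hFH⟩, -⟩ (w | b) hw
    · have hw' : w ∈ F.map f := by rw [hFH]; simpa using hw
      obtain ⟨v, -, rfl⟩ := Finset.mem_map.1 hw'
      exact ⟨Sum.inl v, rfl⟩
    · exact ⟨Sum.inr b, rfl⟩

/-- `⊥` is the void complex, without even the empty face, so the apex of the cone is not a vertex.
-/
theorem mapComplex_some_eq_coneAttach_bot {V : Type*} (K : SComplex V) :
    mapComplex Function.Embedding.some K = coneAttach K ⊥ := by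
  refine mapComplex_eq_of_forall (fun F => ?_) ?_
  · rw [mem_coneAttach, Finset.eraseNone_map_some]
    simp
  · rintro F hF (_ | v) hw
    · exact absurd (hF.2 hw) (by simp)
    · exact ⟨v, rfl⟩

/-- The regrouping of the vertices that identifies the suspension of a cone with a cone over the
suspension. -/
def optionSumEmbedding (V : Type*) : Option V ⊕ Bool ↪ Option (V ⊕ Bool) where
  toFun := Sum.elim (Option.map Sum.inl) fun b => some (Sum.inr b)
  inj' := by
    rintro ((_ | u) | b) ((_ | v) | c) h <;> simp_all

@[simp] theorem optionSumEmbedding_inl_none (V : Type*) :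
    optionSumEmbedding V (Sum.inl none) = none := rfl

@[simp] theorem optionSumEmbedding_inl_some {V : Type*} (v : V) :
    optionSumEmbedding V (Sum.inl (some v)) = some (Sum.inl v) := rfl

@[simp] theorem optionSumEmbedding_inr (V : Type*) (b : Bool) :
    optionSumEmbedding V (Sum.inr b) = some (Sum.inr b) := rfl

theorem mapComplex_suspension_coneAttach {V : Type*} {A B : SComplex V} :
    mapComplex (optionSumEmbedding V) (suspension (coneAttach A B)) =
      coneAttach (suspension A) (suspension B) := by
  refine mapComplex_eq_of_forall (fun F => ?_) ?_
  · have hl : (F.map (optionSumEmbedding V)).eraseNone.toLeft = F.toLeft.eraseNone := by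
      ext v
      simp only [Finset.mem_toLeft, Finset.mem_eraseNone, Finset.mem_map]
      constructor
      · rintro ⟨(_ | u) | b, hu, h⟩ <;> simp at h
        rwa [← h]
      · exact fun h => ⟨_, h, rfl⟩
    have hr : (F.map (optionSumEmbedding V)).eraseNone.toRight = F.toRight := by
      ext v
      simp only [Finset.mem_toRight, Finset.mem_eraseNone, Finset.mem_map]
      constructor
      · rintro ⟨(_ | u) | b, hu, h⟩ <;> simp at h
        rwa [← h]
      · exact fun h => ⟨_, h, rfl⟩
    have hn : none ∈ F.map (optionSumEmbedding V) ↔ none ∈ F.toLeft := by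
      simp only [Finset.mem_toLeft, Finset.mem_map]
      constructor
      · rintro ⟨(_ | u) | b, hu, h⟩ <;> simp at h
        exact hu
      · exact fun h => ⟨_, h, rfl⟩
    simp only [mem_coneAttach, mem_suspension, hl, hr, hn]
    tauto
  · rintro F - (_ | v | b) -
    · exact ⟨Sum.inl none, rfl⟩
    · exact ⟨Sum.inl (some v), rfl⟩
    · exact ⟨Sum.inr b, rfl⟩

variable {V W : Type*} [Fintype V] [Fintype W]

theorem exists_pointedEquiv_of_mapComplex_eq {f : V ↪ W} {K : SComplex V} {K' : SComplex W}
    (h : mapComplex f K = K') (p : realization K) :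
    ∃ q : realization K', PointedEquiv q p := by
  subst h
  exact ⟨_, (PointedEquiv.of_homeomorph (mapHomeomorph f K) p).symm⟩

theorem exists_pointedEquiv_of_eq_mapComplex {f : V ↪ W} {K : SComplex V} {K' : SComplex W}
    (h : mapComplex f K = K') (p : realization K') :
    ∃ q : realization K, PointedEquiv q p := by
  subst h
  exact ⟨_, (PointedEquiv.of_homeomorph (mapHomeomorph f K).symm p).symm⟩

variable [DecidableEq V]

theorem nonempty_realization_suspension {L : SComplex V} (hL : ∅ ∈ L) :
    Nonempty (realization (suspension L)) :=
  ⟨vertexPoint (pole_mem_suspension hL true)⟩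

/-- The pole cannot be prescribed: for `L = {∅}` the suspension is S⁰. -/
theorem exists_joined_pole {L : SComplex V} (hL : ∅ ∈ L) (y : realization (suspension L)) :
    ∃ β, Joined y (vertexPoint (pole_mem_suspension hL β)) := by
  obtain ⟨H, hH, hy⟩ := y.2.2
  rcases H.toRight.eq_empty_or_nonempty with h | ⟨b, hb⟩
  · have h1 : insert (Sum.inr true) H ∈ suspension L := by
      refine mem_suspension.2 ⟨?_, ?_⟩
      · simpa using hH.1
      · simp [h]
    exact ⟨true, joined_vertexPoint h1 y (fun v hv => hy v fun h => hv
      (Finset.mem_insert_of_mem h)) (Finset.mem_insert_self _ _) _⟩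
  · exact ⟨b, joined_vertexPoint hH y hy (by simpa using hb) _⟩

theorem joined_suspension {L : SComplex V} {u : V} (hu : {u} ∈ L)
    (y y' : realization (suspension L)) : Joined y y' := by
  have hL : ∅ ∈ L := L.lower (Finset.empty_subset _) hu
  have h1 : ∀ β, {Sum.inl u, Sum.inr β} ∈ suspension L := fun β => by
    refine mem_suspension.2 ⟨?_, ?_⟩
    · convert hu; ext; simp
    · have : ({Sum.inl u, Sum.inr β} : Finset (V ⊕ Bool)).toRight = {β} := by ext; simp
      simp [this]
  have h2 : {Sum.inl u} ∈ suspension L :=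
    singleton_mem_of_mem (h1 true) (Finset.mem_insert_self _ _)
  have h3 : ∀ y : realization (suspension L), Joined y (vertexPoint h2) := fun y => by
    obtain ⟨β, hβ⟩ := exists_joined_pole hL y
    refine hβ.trans (joined_vertexPoint (h1 β) _ (fun v hv => ?_) (Finset.mem_insert_self _ _) h2)
    show (Pi.single (Sum.inr β) 1 : V ⊕ Bool → ℝ) v = 0
    rw [Pi.single_apply, if_neg]
    rintro rfl
    simp at hv
  exact (h3 y).trans (h3 y').symm

/-- Both gluing points of `coneAttach_equiv_wedge` are moved to `x` and `y`. The marked point `q`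
follows only up to a path to the base point, which suffices to move it later. -/
theorem coneAttach_equiv_wedge_of_joined {X L : SComplex V} {a : V} (hL : ∅ ∈ L)
    (hQ : ∀ F, F.erase a ∈ L → F ∈ X) (ha : {a} ∈ X) {x : realization X}
    (hx : Joined x (vertexPoint ha)) (y : realization (suspension L)) :
    ∃ q : Wedge x y, Joined q (Wedge.base x y) ∧
      PointedEquiv (pushforward _ (mapComplex_some_le_coneAttach X L) x) q := by
  obtain ⟨β, hβ⟩ := exists_joined_pole hL y
  have h1 := coneAttach_equiv_wedge hL hQ β ha (pole_mem_suspension hL β) x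
  have h2 := Wedge.pointedEquiv_of_joined hx.symm
    (wellPointed_realization (vertexPoint (pole_mem_suspension hL β))) x
  have h3 := Wedge.pointedEquiv_of_joined_right (wellPointed_realization x) hβ.symm
    (vertexPoint (pole_mem_suspension hL β))
  rw [Wedge.glue] at h2
  refine ⟨_, ?_, h1.trans (h2.trans h3)⟩
  rw [Wedge.base_eq_inr]
  exact hβ.symm.map (Wedge.inr x y).continuous

end Suspension

/-! ### Packing intervals -/

/-- The complement of `S` in `{0, …, n - 1}` contains `k` disjoint intervals of length `t`. -/
def Packs (t : ℕ) : ℕ → ℕ → Finset ℕ → Prop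
  | 0, _, _ => True
  | k + 1, n, S => ∃ s, s + t ≤ n ∧ (∀ i, s ≤ i → i < s + t → i ∉ S) ∧ Packs t k s S

namespace Packs

variable {t k n : ℕ} {S : Finset ℕ}

theorem congr_subset {S' : Finset ℕ} (hS : ∀ i ∈ S', i < n → i ∈ S) (h : Packs t k n S) :
    Packs t k n S' := by
  induction k generalizing n with
  | zero => trivial
  | succ k ih =>
    obtain ⟨s, hs, h1, h2⟩ := h
    exact ⟨s, hs, fun i hi hi' h => h1 i hi hi' (hS i h (by omega)),
      ih (fun i h hi => hS i h (by omega)) h2⟩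

theorem mono {n' : ℕ} (hn : n ≤ n') (h : Packs t k n S) : Packs t k n' S := by
  cases k with
  | zero => trivial
  | succ k =>
    obtain ⟨s, hs, h⟩ := h
    exact ⟨s, hs.trans hn, h⟩

theorem le (h : Packs t k n S) : k * t ≤ n := by
  induction k generalizing n with
  | zero => simp
  | succ k ih =>
    obtain ⟨s, hs, -, h⟩ := h
    have := ih h
    rw [Nat.succ_mul]
    omega

theorem of_disjoint (hn : k * t ≤ n) (hS : ∀ i < n, i ∉ S) : Packs t k n S := by
  induction k generalizing n with
  | zero => trivial
  | succ k ih =>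
    rw [Nat.succ_mul] at hn
    exact ⟨k * t, hn, fun i _ hi => hS i (by omega), ih le_rfl fun i hi => hS i (by omega)⟩

theorem drop (h : Packs t (k + 1) n S) : Packs t k (n - t) S := by
  obtain ⟨s, hs, -, h⟩ := h
  exact h.mono (by omega)

theorem notMem_of_tight (h : Packs t k (k * t) S) : ∀ i < k * t, i ∉ S := by
  induction k with
  | zero => simp
  | succ k ih =>
    obtain ⟨s, hs, h1, h2⟩ := h
    have := h2.le
    rw [Nat.succ_mul] at hs ⊢
    obtain rfl : s = k * t := by omega
    intro i hi
    rcases lt_or_ge i (k * t) with h | h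
    · exact ih h2 i h
    · exact h1 i h hi

/-- The last `t` places are free, so the last interval can be pushed there. -/
theorem succ_add_iff (hS : ∀ i ∈ S, n ≤ i → n + t ≤ i) :
    Packs t (k + 1) (n + t) S ↔ Packs t k n S := by
  constructor
  · intro h
    simpa using h.drop
  · exact fun h => ⟨n, le_rfl, fun i hi hi' h' => by have := hS i h' hi; omega, h⟩

/-- Fewer than `t` places lie to the right of `i`, so no interval of the packing starts after `i`.
-/
theorem of_mem {i : ℕ} (hi : i ∈ S) (hn : n ≤ i + t) (h : Packs t (k + 1) n S) :
    Packs t (k + 1) i S := by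
  obtain ⟨s, hs, h1, h2⟩ := h
  refine ⟨s, ?_, h1, h2⟩
  by_contra hlt
  exact h1 i (by omega) (by omega) hi

end Packs

/-! ### The packing complex as a cone attachment. -/

/-- The complex of the subsets of `{0, …, n - 1}` whose complement contains `k` disjoint intervals
of length `t`. -/
def packComplex (t k n : ℕ) : SComplex (Fin n) where
  carrier := {G | Packs t k n (G.map Fin.valEmbedding)}
  lower' := fun _ _ h hG => Packs.congr_subset (fun _ hi _ => Finset.map_subset_map.2 h hi) hG

variable {t k n m : ℕ}

theorem mem_packComplex {G : Finset (Fin n)} :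
    G ∈ packComplex t k n ↔ Packs t k n (G.map Fin.valEmbedding) := Iff.rfl

theorem empty_mem_packComplex (h : k * t ≤ n) : ∅ ∈ packComplex t k n :=
  Packs.of_disjoint h (by simp)

theorem last_mem_packComplex (h : k * t ≤ m) : {Fin.last m} ∈ packComplex t k (m + 1) := by
  refine Packs.mono (Nat.le_succ m) (Packs.of_disjoint h fun i hi => ?_)
  simp only [Finset.map_singleton, Finset.mem_singleton]
  rintro rfl
  simp at hi

/-- The base of the cone that is attached to `packComplex t k (m + 1)`. -/
def packBase (t k m : ℕ) : SComplex (Fin (m + 1)) where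
  carrier := {G | Packs t (k + 1) (m + t) (G.map Fin.valEmbedding)}
  lower' := fun _ _ h hG => Packs.congr_subset (fun _ hi _ => Finset.map_subset_map.2 h hi) hG

theorem mem_packBase {G : Finset (Fin (m + 1))} :
    G ∈ packBase t k m ↔ Packs t (k + 1) (m + t) (G.map Fin.valEmbedding) := Iff.rfl

theorem empty_mem_packBase (h : k * t ≤ m) : ∅ ∈ packBase t k m :=
  Packs.of_disjoint (by rw [Nat.succ_mul]; omega) (by simp)

/-- The vertices of the cone attached to `packComplex t k (m + 1)`, inside `m + 1 + t` vertices. -/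
def coneEmbedding (m t : ℕ) (ht : 1 ≤ t) : Option (Fin (m + 1)) ↪ Fin (m + 1 + t) where
  toFun o := o.elim ⟨m + t, by omega⟩ (Fin.castAdd t)
  inj' := by
    rintro (_ | u) (_ | v) h
    · rfl
    · have := congrArg Fin.val h
      simp at this
      omega
    · have := congrArg Fin.val h
      simp at this
      omega
    · have := congrArg Fin.val h
      simp at this
      rw [Fin.ext this]

theorem coneEmbedding_none (ht : 1 ≤ t) : (coneEmbedding m t ht none).1 = m + t := rfl

theorem coneEmbedding_some (ht : 1 ≤ t) (i : Fin (m + 1)) :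
    (coneEmbedding m t ht (some i)).1 = i.1 := rfl

theorem mem_map_coneEmbedding (ht : 1 ≤ t) {G : Finset (Option (Fin (m + 1)))} {i : ℕ} :
    i ∈ (G.map (coneEmbedding m t ht)).map Fin.valEmbedding ↔
      (i = m + t ∧ none ∈ G) ∨ i ∈ G.eraseNone.map Fin.valEmbedding := by
  simp only [Finset.mem_map, Finset.mem_eraseNone, Fin.valEmbedding_apply]
  constructor
  · rintro ⟨_, ⟨_ | v, hv, rfl⟩, rfl⟩
    · exact Or.inl ⟨rfl, hv⟩
    · exact Or.inr ⟨v, hv, rfl⟩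
  · rintro (⟨rfl, h⟩ | ⟨v, hv, rfl⟩)
    · exact ⟨_, ⟨none, h, rfl⟩, rfl⟩
    · exact ⟨_, ⟨some v, hv, rfl⟩, rfl⟩

theorem lt_of_mem_map_val {G : Finset (Fin n)} {i : ℕ} (h : i ∈ G.map Fin.valEmbedding) :
    i < n := by
  obtain ⟨v, -, rfl⟩ := Finset.mem_map.1 h
  exact v.2

/-- Without the vertex `m + t` the last interval is pushed to the right end; with it, the packing
must lie to its left, by `Packs.of_mem`. -/
theorem map_coneEmbedding_mem (ht : 1 ≤ t) {G : Finset (Option (Fin (m + 1)))} :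
    G.map (coneEmbedding m t ht) ∈ packComplex t (k + 1) (m + 1 + t) ↔
      G ∈ coneAttach (packComplex t k (m + 1)) (packBase t k m) := by
  rw [mem_packComplex, mem_coneAttach, mem_packComplex, mem_packBase]
  have hlt : ∀ i ∈ G.eraseNone.map Fin.valEmbedding, i < m + 1 := fun i => lt_of_mem_map_val
  by_cases hn : none ∈ G
  · have hX : Packs t (k + 1) (m + t) (G.eraseNone.map Fin.valEmbedding) →
        Packs t k (m + 1) (G.eraseNone.map Fin.valEmbedding) := fun h => by
      have := h.drop
      rw [Nat.add_sub_cancel] at this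
      exact this.mono (Nat.le_succ m)
    have hA : Packs t (k + 1) (m + 1 + t) ((G.map (coneEmbedding m t ht)).map Fin.valEmbedding) ↔
        Packs t (k + 1) (m + t) (G.eraseNone.map Fin.valEmbedding) := by
      constructor
      · intro h
        refine (h.of_mem (i := m + t) ?_ (by omega)).congr_subset ?_
        · exact (mem_map_coneEmbedding ht).2 (Or.inl ⟨rfl, hn⟩)
        · exact fun i hi _ => (mem_map_coneEmbedding ht).2 (Or.inr hi)
      · intro h
        refine Packs.mono (n := m + t) (by omega) (h.congr_subset fun i hi hi' => ?_)
        rcases (mem_map_coneEmbedding ht).1 hi with h | h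
        · omega
        · exact h
    rw [hA]
    tauto
  · have hS : (G.map (coneEmbedding m t ht)).map Fin.valEmbedding =
        G.eraseNone.map Fin.valEmbedding := by
      ext i
      rw [mem_map_coneEmbedding]
      simp [hn]
    rw [hS, Packs.succ_add_iff fun i hi hi' => by have := hlt i hi; omega]
    tauto

theorem mapComplex_coneEmbedding_le (ht : 1 ≤ t) : mapComplex (coneEmbedding m t ht)
    (coneAttach (packComplex t k (m + 1)) (packBase t k m)) ≤
      packComplex t (k + 1) (m + 1 + t) := by
  rintro _ ⟨G, hG, rfl⟩
  exact (map_coneEmbedding_mem ht).2 hG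

theorem packComplex_equiv_coneAttach (ht : 1 ≤ t) (hm : k * t ≤ m)
    (p : realization (coneAttach (packComplex t k (m + 1)) (packBase t k m))) :
    ∃ q : realization (packComplex t (k + 1) (m + 1 + t)), PointedEquiv q p := by
  have h1 := PointedEquiv.of_homeomorph (mapHomeomorph (coneEmbedding m t ht) _) p
  refine ⟨_, (collapse (mapComplex_coneEmbedding_le ht) ?_ (coneEmbedding m t ht none) ?_ ?_
    (mapHomeomorph (coneEmbedding m t ht) _ p)).trans h1.symm⟩
  · refine ⟨∅, ⟨empty_mem_packComplex (by omega), by simp⟩, by simp⟩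
  all_goals
    intro F hF hF'
    -- Such an `i` keeps the face outside the cone attachment and confines the packing to the left
    -- of `i`, so the status of the vertex `m + t` is irrelevant.
    obtain ⟨i, hi, him, hi'⟩ : ∃ i ∈ F, m + 1 ≤ i.1 ∧ i.1 < m + t := by
      by_contra! h
      have hsub : (F : Set (Fin (m + 1 + t))) ⊆ coneEmbedding m t ht '' Set.univ := by
        intro i hi
        rcases lt_or_ge i.1 (m + 1) with hlt | hge
        · exact ⟨some ⟨i.1, hlt⟩, trivial, Fin.ext rfl⟩
        · exact ⟨none, trivial, Fin.ext (by
            have := h i hi hge; have := i.2; rw [coneEmbedding_none]; omega)⟩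
      obtain ⟨G, -, rfl⟩ := Finset.subset_set_image_iff.1 hsub
      rw [← Finset.map_eq_image] at hF hF'
      exact hF' ⟨G, (map_coneEmbedding_mem ht).1 hF, rfl⟩
  · have h2 : Packs t (k + 1) i.1 (F.map Fin.valEmbedding) :=
      Packs.of_mem (Finset.mem_map_of_mem Fin.valEmbedding hi) (by omega) hF
    refine Packs.mono (n := i.1) (by omega) (h2.congr_subset fun j hj hj' => ?_)
    rw [Finset.map_insert, Finset.mem_insert] at hj
    rcases hj with rfl | hj
    · have := coneEmbedding_none (m := m) ht
      simp only [Fin.valEmbedding_apply] at hj'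
      omega
    · exact hj
  · rintro ⟨G, -, hG⟩
    have h2 : i ∈ F.erase (coneEmbedding m t ht none) := by
      refine Finset.mem_erase.2 ⟨?_, hi⟩
      rintro rfl
      rw [coneEmbedding_none] at hi'
      omega
    rw [← hG] at h2
    obtain ⟨_ | v, -, rfl⟩ := Finset.mem_map.1 h2
    · rw [coneEmbedding_none] at hi'
      omega
    · have := v.2
      rw [coneEmbedding_some] at him
      omega

/-- The vertices of `Fin (m + 1)`, the last of them being `none`. -/
def lastEmbedding (m : ℕ) : Option (Fin m) ↪ Fin (m + 1) where
  toFun o := o.elim (Fin.last m) Fin.castSucc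
  inj' := by
    rintro (_ | u) (_ | v) h
    · rfl
    · exact absurd h.symm (Fin.castSucc_ne_last v)
    · exact absurd h (Fin.castSucc_ne_last u)
    · rw [Fin.castSucc_injective m h]

/-- If the vertex `m` is in the face, all `k + 1` intervals lie below `m`; if not, the last one can
be pushed to start at `m`. -/
theorem mapComplex_lastEmbedding : mapComplex (lastEmbedding m)
    (coneAttach (packComplex t k m) (packComplex t (k + 1) m)) = packBase t k m := by
  refine mapComplex_eq_of_forall (fun G => ?_) fun F _ i _ => ?_
  · rw [mem_packBase, mem_coneAttach, mem_packComplex, mem_packComplex]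
    have hG : ∀ i, i ∈ (G.map (lastEmbedding m)).map Fin.valEmbedding ↔
        (i = m ∧ none ∈ G) ∨ i ∈ G.eraseNone.map Fin.valEmbedding := by
      intro i
      simp only [Finset.mem_map, Finset.mem_eraseNone, Fin.valEmbedding_apply]
      constructor
      · rintro ⟨_, ⟨_ | v, hv, rfl⟩, rfl⟩
        · exact Or.inl ⟨rfl, hv⟩
        · exact Or.inr ⟨v, hv, rfl⟩
      · rintro (⟨rfl, h⟩ | ⟨v, hv, rfl⟩)
        · exact ⟨_, ⟨none, h, rfl⟩, rfl⟩
        · exact ⟨_, ⟨some v, hv, rfl⟩, rfl⟩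
    have hlt : ∀ i ∈ G.eraseNone.map Fin.valEmbedding, i < m := fun i => lt_of_mem_map_val
    have hcongr : ∀ j, Packs t j m ((G.map (lastEmbedding m)).map Fin.valEmbedding) ↔
        Packs t j m (G.eraseNone.map Fin.valEmbedding) := fun j => by
      refine ⟨fun h => h.congr_subset fun i hi _ => (hG i).2 (Or.inr hi),
        fun h => h.congr_subset fun i hi hi' => ?_⟩
      rcases (hG i).1 hi with h | h
      · omega
      · exact h
    by_cases hn : none ∈ G
    · have hX : Packs t (k + 1) m (G.eraseNone.map Fin.valEmbedding) →
          Packs t k m (G.eraseNone.map Fin.valEmbedding) := fun h => h.drop.mono (Nat.sub_le m t)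
      have h1 : Packs t (k + 1) (m + t) ((G.map (lastEmbedding m)).map Fin.valEmbedding) ↔
          Packs t (k + 1) m ((G.map (lastEmbedding m)).map Fin.valEmbedding) :=
        ⟨fun h => h.of_mem ((hG m).2 (Or.inl ⟨rfl, hn⟩)) le_rfl,
          fun h => h.mono (Nat.le_add_right m t)⟩
      rw [h1, hcongr]
      tauto
    · have h2 : ∀ i ∈ (G.map (lastEmbedding m)).map Fin.valEmbedding, m ≤ i → m + t ≤ i := by
        intro i hi hi'
        rcases (hG i).1 hi with h | h
        · exact absurd h.2 hn
        · have := hlt i h; omega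
      rw [Packs.succ_add_iff h2, hcongr]
      tauto
  · refine Fin.lastCases ⟨none, rfl⟩ (fun v => ⟨some v, rfl⟩) i

theorem packComplex_eq_bot (h : n < k * t) : packComplex t k n = ⊥ := by
  ext G
  refine ⟨fun hG => ?_, fun hG => absurd hG (by simp)⟩
  exact absurd (Packs.le hG) (by omega)

theorem mem_of_erase_last_mem_packBase (F : Finset (Fin (m + 1)))
    (h : F.erase (Fin.last m) ∈ packBase t k m) : F ∈ packComplex t k (m + 1) := by
  have h1 := Packs.drop h
  rw [Nat.add_sub_cancel] at h1
  refine Packs.mono (Nat.le_succ m) (h1.congr_subset fun i hi him => ?_)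
  obtain ⟨v, hv, rfl⟩ := Finset.mem_map.1 hi
  refine Finset.mem_map_of_mem _ (Finset.mem_erase.2 ⟨?_, hv⟩)
  rintro rfl
  simp at him

/-- In the tight case the `k + 1` intervals fill all the places, so the only face of `packBase` is
empty and `F ⊆ {a}`. -/
theorem mem_of_erase_mem_packBase_of_tight {a : Fin (k * t + 1)}
    (ha : {a} ∈ packComplex t k (k * t + 1)) (F : Finset (Fin (k * t + 1)))
    (h : F.erase a ∈ packBase t k (k * t)) (ht : 1 ≤ t) : F ∈ packComplex t k (k * t + 1) := by
  rw [mem_packBase, ← Nat.succ_mul] at h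
  have h1 := Packs.notMem_of_tight h
  refine (packComplex t k (k * t + 1)).lower ?_ ha
  intro v hv
  by_contra hva
  refine h1 v.1 ?_ (Finset.mem_map_of_mem Fin.valEmbedding
    (Finset.mem_erase.2 ⟨by simpa using hva, hv⟩))
  have := v.2
  rw [Nat.succ_mul]
  omega

theorem mem_of_erase_mem_packComplex (ht : 1 ≤ t) (F : Finset (Fin (m + 1)))
    (h : F.erase (Fin.last m) ∈ packComplex t (k + 1) (m + 1)) : F ∈ packComplex t k (m + 1) := by
  refine Packs.mono (Nat.sub_le (m + 1) t) ((Packs.drop h).congr_subset fun i hi him => ?_)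
  obtain ⟨v, hv, rfl⟩ := Finset.mem_map.1 hi
  refine Finset.mem_map_of_mem _ (Finset.mem_erase.2 ⟨?_, hv⟩)
  rintro rfl
  simp at him
  omega

/-! ### Path connectedness of the packing complex. -/

theorem joined_packComplex (ht : 1 ≤ t) (hn : k * t + 2 ≤ n)
    (p q : realization (packComplex t k n)) : Joined p q := by
  induction k generalizing n with
  | zero => exact joined_of_common_face (K := packComplex t 0 n) (F := Finset.univ) trivial p q (by simp) (by simp)
  | succ k ih =>
    obtain ⟨m, rfl⟩ : ∃ m, n = m + 2 + t := ⟨n - 2 - t, by rw [Nat.succ_mul] at hn; omega⟩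
    have hm : k * t ≤ m := by rw [Nat.succ_mul] at hn; omega
    have edge : ∀ {i j : Fin (m + 2 + t)} (hi : {i} ∈ packComplex t (k + 1) (m + 2 + t))
        (hj : {j} ∈ packComplex t (k + 1) (m + 2 + t)),
        {i, j} ∈ packComplex t (k + 1) (m + 2 + t) →
        Joined (vertexPoint hi) (vertexPoint hj) := fun {i j} hi hj h => by
      refine joined_vertexPoint h _ (fun v hv => ?_) (by simp) hj
      show (Pi.single i 1 : Fin (m + 2 + t) → ℝ) v = 0
      rw [Pi.single_apply, if_neg]
      rintro rfl
      simp at hv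
    -- Everything is joined to the last vertex `w`. Vertices beyond `m + 1` span an edge with it;
    -- the others lie in a copy of the complex for `k`, connected by induction, whose vertex `m`
    -- spans an edge with `w`.
    let w : Fin (m + 2 + t) := ⟨m + 1 + t, by omega⟩
    have hu : ({⟨m, by omega⟩, w} : Finset (Fin (m + 2 + t))) ∈
        packComplex t (k + 1) (m + 2 + t) := by
      refine Packs.mono (n := m + 1 + t) (by omega) ((Packs.succ_add_iff ?_).2
        (Packs.mono (Nat.le_succ m) (Packs.of_disjoint hm ?_)))
      · intro i hi him
        simp [w] at hi
        omega
      · intro i hi him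
        simp [w] at him
        omega
    have hw := singleton_mem_of_mem hu (v := w) (by simp)
    have hu' := singleton_mem_of_mem hu (v := ⟨m, by omega⟩) (by simp)
    have hle : mapComplex (Fin.castAddEmb t) (packComplex t k (m + 2)) ≤
        packComplex t (k + 1) (m + 2 + t) := by
      rintro _ ⟨G, hG, rfl⟩
      have e : (G.map (Fin.castAddEmb t)).map Fin.valEmbedding = G.map Fin.valEmbedding := by
        ext; simp
      show Packs t (k + 1) _ _
      rw [e]
      refine (Packs.succ_add_iff fun i hi hi' => ?_).2 hG
      have := lt_of_mem_map_val hi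
      omega
    have key : ∀ (i : Fin (m + 2 + t)) (hi : {i} ∈ packComplex t (k + 1) (m + 2 + t)),
        Joined (vertexPoint hi) (vertexPoint hw) := by
      intro i hi
      rcases lt_or_ge i.1 (m + 2) with hlt | hge
      · have hi' : {(⟨i.1, hlt⟩ : Fin (m + 2))} ∈ packComplex t k (m + 2) := by
          have := Packs.drop hi
          rw [Nat.add_sub_cancel] at this
          simpa [mem_packComplex] using this
        have hum : {(⟨m, by omega⟩ : Fin (m + 2))} ∈ packComplex t k (m + 2) := by
          refine Packs.mono (n := m) (by omega) (Packs.of_disjoint hm fun j hj => ?_)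
          simp
          omega
        have h1 := (ih (by omega) (vertexPoint hi') (vertexPoint hum)).map
          (pushforward (Fin.castAddEmb t) hle).continuous
        rw [pushforward_vertexPoint _ hle hi' hi, pushforward_vertexPoint _ hle hum hu'] at h1
        exact h1.trans (edge hu' hw hu)
      · refine edge hi hw ?_
        have h1 := Packs.of_mem (i := i.1) (by simp) (by omega) hi
        refine Packs.mono (n := i.1) (by omega) (h1.congr_subset fun j hj hj' => ?_)
        simp [w] at hj ⊢
        omega
    obtain ⟨i, hi, hpi⟩ := exists_joined_vertexPoint p
    obtain ⟨j, hj, hqj⟩ := exists_joined_vertexPoint q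
    exact (hpi.trans (key i hi)).trans (hqj.trans (key j hj)).symm

/-! ### Squarefree powers of path ideals -/

theorem Packs.of_multiset {t : ℕ} {S : Finset ℕ} {k N : ℕ} {m : Multiset ℕ}
    (hk : m.card = k) (ht : 1 ≤ t)
    (hN : ∀ s ∈ m, s + t ≤ N)
    (hc : ∀ i, m.countP (fun s => s ≤ i ∧ i < s + t) ≤ if i ∈ S then 0 else 1) :
    Packs t k N S := by
  induction k generalizing m N with
  | zero => trivial
  | succ k ih =>
    have hne : m.toFinset.Nonempty := by
      rw [Multiset.toFinset_nonempty]
      rintro rfl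
      simp at hk
    obtain ⟨s, hs, hmax⟩ := Finset.exists_max_image m.toFinset id hne
    simp only [Multiset.mem_toFinset, id] at hs hmax
    obtain ⟨m', rfl⟩ := Multiset.exists_cons_of_mem hs
    simp only [Multiset.card_cons, Nat.add_right_cancel_iff] at hk
    refine ⟨s, hN s hs, fun i hi hi' hiS => ?_, ih hk (fun r hr => ?_) fun i => ?_⟩
    · have := hc i
      rw [if_pos hiS, Multiset.countP_cons_of_pos _ ⟨hi, hi'⟩] at this
      omega
    · have h1 := hmax r (Multiset.mem_cons_of_mem hr)
      -- An interval starting no later than `s` and ending after it would cover `s` a second time;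
      -- `1 ≤ t` ensures that the interval at `s` covers its own start.
      by_contra h2
      have h3 := hc s
      rw [Multiset.countP_cons_of_pos _ ⟨le_rfl, Nat.lt_add_of_pos_right ht⟩] at h3
      have h4 : 0 < m'.countP (fun r => r ≤ s ∧ s < r + t) :=
        Multiset.countP_pos.2 ⟨r, hr, h1, by omega⟩
      split_ifs at h3 <;> omega
    · exact (Multiset.countP_le_of_le _ (Multiset.le_cons_self m' s)).trans (hc i)

theorem Packs.exists_multiset {t : ℕ} {S : Finset ℕ} {k N : ℕ} (h : Packs t k N S) :
    ∃ m : Multiset ℕ, m.card = k ∧ (∀ s ∈ m, s + t ≤ N) ∧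
      ∀ i, m.countP (fun s => s ≤ i ∧ i < s + t) ≤ if i ∈ S then 0 else 1 := by
  induction k generalizing N with
  | zero => exact ⟨0, by simp⟩
  | succ k ih =>
    obtain ⟨s, hs, h1, h2⟩ := h
    obtain ⟨m, hm, hN, hc⟩ := ih h2
    refine ⟨s ::ₘ m, by simp [hm], fun r hr => ?_, fun i => ?_⟩
    · rcases Multiset.mem_cons.1 hr with rfl | hr
      · exact hs
      · have := hN r hr; omega
    · by_cases hi : s ≤ i ∧ i < s + t
      · have h0 : m.countP (fun s => s ≤ i ∧ i < s + t) = 0 :=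
          Multiset.countP_eq_zero.2 fun r hr => by have := hN r hr; omega
        rw [Multiset.countP_cons_of_pos (p := fun s => s ≤ i ∧ i < s + t) _ hi, h0, if_neg (h1 i hi.1 hi.2)]
      · rw [Multiset.countP_cons_of_neg (p := fun s => s ≤ i ∧ i < s + t) _ hi]
        exact hc i

/-! ### Paths of the path graph as intervals. -/

section Paths

variable {n : ℕ}

theorem mem_support_of_isPath {u v : Fin n} (p : (SimpleGraph.pathGraph n).Walk u v)
    (hp : p.IsPath) : ∀ i : Fin n, i ∈ p.support ↔ min u v ≤ i ∧ i ≤ max u v := by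
  induction p with
  | nil => simp [le_antisymm_iff, and_comm]
  | @cons u w v h p ih =>
    rw [SimpleGraph.Walk.cons_isPath_iff] at hp
    have hu := hp.2
    rw [ih hp.1] at hu
    intro i
    rw [SimpleGraph.Walk.support_cons, List.mem_cons, ih hp.1]
    rw [SimpleGraph.pathGraph_adj] at h
    simp only [Fin.le_def, Fin.ext_iff, min_def, max_def] at *
    split_ifs at * <;> omega

theorem exists_isPath (d s : ℕ) (h : s + d < n) :
    ∃ (v : Fin n) (p : (SimpleGraph.pathGraph n).Walk ⟨s, by omega⟩ v),
      p.IsPath ∧ p.length = d ∧ v.1 = s + d ∧ ∀ i ∈ p.support, s ≤ i.1 := by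
  induction d generalizing s with
  | zero => exact ⟨_, .nil, by simp⟩
  | succ d ih =>
    obtain ⟨v, p, hp, hl, hv, hs⟩ := ih (s + 1) (by omega)
    have hadj : (SimpleGraph.pathGraph n).Adj ⟨s, by omega⟩ ⟨s + 1, by omega⟩ := by
      rw [SimpleGraph.pathGraph_adj]; simp
    refine ⟨v, .cons hadj p, ?_, by simp [hl], by omega, ?_⟩
    · rw [SimpleGraph.Walk.cons_isPath_iff]
      refine ⟨hp, fun h => ?_⟩
      have := hs _ h
      simp at this
    · intro i hi
      rw [SimpleGraph.Walk.support_cons, List.mem_cons] at hi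
      rcases hi with rfl | hi
      · simp
      · have := hs i hi; omega

end Paths

/-! ### Monomials in powers and squarefree powers. -/

section Ideals

open MvPolynomial

variable {K : Type*} [Field K]

/-- The exponent of the squarefree monomial with support `F`. -/
noncomputable def exponent {V : Type*} (F : Finset V) : V →₀ ℕ :=
  ∑ i ∈ F, Finsupp.single i 1

theorem exponent_apply {V : Type*} [DecidableEq V] (F : Finset V) (i : V) :
    exponent F i = if i ∈ F then 1 else 0 := by
  simp [exponent, Finsupp.finsetSum_apply, Finsupp.single_apply]

theorem prod_X_eq_monomial {V : Type*} (F : Finset V) :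
    ∏ i ∈ F, (X i : MvPolynomial V K) = monomial (exponent F) 1 := by
  rw [exponent, monomial_sum_one]
  rfl

/-- The vertices of the interval of length `t` that starts at `s`. -/
def interval (n t s : ℕ) : Finset (Fin n) := Finset.univ.filter fun i => s ≤ i.1 ∧ i.1 < s + t

theorem mem_interval {n t s : ℕ} {i : Fin n} : i ∈ interval n t s ↔ s ≤ i.1 ∧ i.1 < s + t := by
  simp [interval]

theorem tPathIdeal_eq (K : Type*) [Field K] (n t : ℕ) (ht : 1 ≤ t) :
    tPathIdeal K (SimpleGraph.pathGraph n) t =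
      Ideal.span ((fun e => monomial e (1 : K)) ''
        {e | ∃ s, s + t ≤ n ∧ e = exponent (interval n t s)}) := by
  have key : ∀ {u v : Fin n} (p : (SimpleGraph.pathGraph n).Walk u v), p.IsPath →
      (p.support.map X).prod = monomial (exponent p.support.toFinset) (1 : K) := by
    intro u v p hp
    rw [← prod_X_eq_monomial, List.prod_toFinset _ hp.support_nodup]
  have hcard : ∀ {u v : Fin n} (p : (SimpleGraph.pathGraph n).Walk u v), p.IsPath →
      p.support.length = t → (min u v).1 + t = (max u v).1 + 1 ∧
      p.support.toFinset = interval n t (min u v).1 := by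
    intro u v p hp hl
    have h1 : p.support.toFinset = Finset.Icc (min u v) (max u v) := by
      ext i
      rw [List.mem_toFinset, mem_support_of_isPath p hp, Finset.mem_Icc]
    have h2 : p.support.toFinset.card = t := by
      rw [List.toFinset_card_of_nodup hp.support_nodup, hl]
    have h3 : (min u v).1 ≤ (max u v).1 := min_le_max
    have h4 : (min u v).1 + t = (max u v).1 + 1 := by
      rw [h1, Fin.card_Icc] at h2
      omega
    refine ⟨h4, ?_⟩
    rw [h1]
    ext i
    rw [Finset.mem_Icc, mem_interval, Fin.le_def, Fin.le_def]
    omega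
  unfold tPathIdeal
  congr 1
  ext f
  constructor
  · rintro ⟨u, v, p, hp, hl, rfl⟩
    obtain ⟨h1, h2⟩ := hcard p hp hl
    refine ⟨_, ⟨(min u v).1, ?_, rfl⟩, ?_⟩
    · have := (max u v).2; omega
    · rw [key p hp, h2]
  · rintro ⟨_, ⟨s, hs, rfl⟩, rfl⟩
    obtain ⟨v, p, hp, hl, hv, -⟩ := exists_isPath (n := n) (t - 1) s (by omega)
    have hl' : p.support.length = t := by
      rw [SimpleGraph.Walk.length_support, hl]; omega
    refine ⟨_, v, p, hp, hl', ?_⟩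
    rw [key p hp, (hcard p hp hl').2]
    have : (min (⟨s, by omega⟩ : Fin n) v).1 = s := by
      rw [min_eq_left]
      rw [Fin.le_def]
      simp only
      omega
    rw [this]

theorem span_monomial_pow {V : Type*} {ι : Type*} (P : ι → Prop) (E : ι → V →₀ ℕ) (k : ℕ) :
    Ideal.span ((fun e => monomial e (1 : K)) '' {e | ∃ s, P s ∧ e = E s}) ^ k =
      Ideal.span ((fun e => monomial e (1 : K)) ''
        {e | ∃ m : Multiset ι, m.card = k ∧ (∀ s ∈ m, P s) ∧ e = (m.map E).sum}) := by
  induction k with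
  | zero =>
    rw [pow_zero, Ideal.one_eq_top, eq_comm, Ideal.eq_top_iff_one]
    refine Ideal.subset_span ⟨0, ⟨0, by simp⟩, ?_⟩
    simp
  | succ k ih =>
    rw [pow_succ, ih, Ideal.span_mul_span']
    congr 1
    ext f
    simp only [Set.mem_mul, Set.mem_image]
    constructor
    · rintro ⟨_, ⟨_, ⟨m, hm, hP, rfl⟩, rfl⟩, _, ⟨_, ⟨s, hs, rfl⟩, rfl⟩, rfl⟩
      refine ⟨_, ⟨s ::ₘ m, by simp [hm], fun r hr => ?_, rfl⟩, ?_⟩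
      · rcases Multiset.mem_cons.1 hr with rfl | hr
        · exact hs
        · exact hP r hr
      · rw [monomial_mul, Multiset.map_cons, Multiset.sum_cons, add_comm, one_mul]
    · rintro ⟨_, ⟨m, hm, hP, rfl⟩, rfl⟩
      obtain ⟨s, hs⟩ := Multiset.card_pos_iff_exists_mem.1 (by omega : 0 < m.card)
      obtain ⟨m', rfl⟩ := Multiset.exists_cons_of_mem hs
      refine ⟨_, ⟨_, ⟨m', by simpa using hm, fun r hr => hP r (Multiset.mem_cons_of_mem hr), rfl⟩,
        rfl⟩, _, ⟨_, ⟨s, hP s hs, rfl⟩, rfl⟩, ?_⟩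
      rw [monomial_mul, Multiset.map_cons, Multiset.sum_cons, add_comm, one_mul]

theorem monomial_mem_of_le {V : Type*} {J : Ideal (MvPolynomial V K)} {a b : V →₀ ℕ}
    (ha : monomial a (1 : K) ∈ J) (h : a ≤ b) : monomial b (1 : K) ∈ J :=
  J.mem_of_dvd (monomial_dvd_monomial.2 ⟨Or.inr h, one_dvd _⟩) ha

/-- A minimal monomial of `J ^ k` dividing a squarefree monomial is itself squarefree. -/
theorem prod_X_mem_squarefreePower {V : Type*} [Finite V] {J : Ideal (MvPolynomial V K)} {k : ℕ}
    (F : Finset V) : ∏ i ∈ F, (X i : MvPolynomial V K) ∈ squarefreePower J k ↔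
      monomial (exponent F) (1 : K) ∈ J ^ k := by
  classical
  have hsq : squarefreePower J k = Ideal.span ((fun e => monomial e (1 : K)) ''
      {a | a ∈ minimalGenerators (J ^ k) ∧ ∀ i, a i ≤ 1}) := by
    unfold squarefreePower
    congr 1
    ext f
    constructor
    · rintro ⟨a, h1, h2, rfl⟩; exact ⟨a, ⟨h1, h2⟩, rfl⟩
    · rintro ⟨a, ⟨h1, h2⟩, rfl⟩; exact ⟨a, h1, h2, rfl⟩
  rw [prod_X_eq_monomial, hsq, mem_ideal_span_monomial_image]
  have hsupp : (monomial (exponent F) (1 : K)).support = {exponent F} := by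
    rw [support_monomial, if_neg one_ne_zero]
  simp only [hsupp, Finset.mem_singleton, forall_eq]
  constructor
  · rintro ⟨a, ⟨ha, -⟩, hle⟩
    exact monomial_mem_of_le ha.1 hle
  · intro h
    obtain ⟨a, hle, ha⟩ := exists_minimal_le_of_wellFoundedLT
      (fun b => monomial b (1 : K) ∈ J ^ k) (exponent F) h
    refine ⟨a, ⟨ha, fun i => (hle i).trans ?_⟩, hle⟩
    rw [exponent_apply]
    split_ifs <;> omega

/-- The two complements in the Alexander dual of a Stanley–Reisner complex make `G` a face when the
monomial of `Gᶜ` lies in the ideal. It does when `k` interval monomials have a product dividing it,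
that is, when the intervals cover each place of `Gᶜ` at most once and no place of `G`. -/
theorem pathComplex_eq (K : Type*) [Field K] (n t : ℕ) (ht : 1 ≤ t) (k : ℕ) :
    pathComplex K n t k = packComplex t k n := by
  cases k with
  | zero =>
    ext G
    exact ⟨fun _ => trivial, fun _ => trivial⟩
  | succ k =>
    classical
    ext G
    have h1 : G ∈ pathComplex K n t (k + 1) ↔ ∏ i ∈ Gᶜ, (X i : MvPolynomial (Fin n) K) ∈
        squarefreePower (tPathIdeal K (SimpleGraph.pathGraph n) t) (k + 1) := by
      constructor
      · rintro ⟨F, hF, rfl⟩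
        rw [compl_compl]
        exact not_not.1 hF
      · exact fun h => ⟨Gᶜ, fun hF => hF h, (compl_compl G).symm⟩
    refine h1.trans ?_
    rw [prod_X_mem_squarefreePower, tPathIdeal_eq K n t ht, span_monomial_pow,
      mem_ideal_span_monomial_image]
    have hsupp : (monomial (exponent Gᶜ) (1 : K)).support = {exponent Gᶜ} := by
      rw [support_monomial, if_neg one_ne_zero]
    simp only [hsupp, Finset.mem_singleton, forall_eq]
    have happ : ∀ (m : Multiset ℕ) (i : Fin n),
        (m.map fun s => exponent (interval n t s)).sum i =
          m.countP fun s => s ≤ i.1 ∧ i.1 < s + t := by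
      intro m i
      induction m using Multiset.induction_on with
      | empty => simp
      | cons s m ih =>
        rw [Multiset.map_cons, Multiset.sum_cons, Finsupp.add_apply, ih, exponent_apply,
          Multiset.countP_cons, add_comm]
        simp only [mem_interval]
    have hG : ∀ i : Fin n, exponent Gᶜ i = if i.1 ∈ G.map Fin.valEmbedding then 0 else 1 := by
      intro i
      rw [exponent_apply]
      have : i.1 ∈ G.map Fin.valEmbedding ↔ i ∈ G := Finset.mem_map' Fin.valEmbedding
      simp [this]
    constructor
    · rintro ⟨_, ⟨m, hm, hN, rfl⟩, hle⟩
      refine Packs.of_multiset hm ht hN fun i => ?_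
      rcases lt_or_ge i n with hi | hi
      · have := hle ⟨i, hi⟩
        rwa [happ, hG] at this
      · refine (Multiset.countP_eq_zero.2 fun r hr => ?_).le.trans (Nat.zero_le _)
        have := hN r hr
        omega
    · intro h
      obtain ⟨m, hm, hN, hc⟩ := Packs.exists_multiset h
      refine ⟨_, ⟨m, hm, hN, rfl⟩, fun i => ?_⟩
      rw [happ, hG]
      exact hc i

end Ideals

/-! ### The wedge decomposition -/

section Decomposition

variable {t k m : ℕ}

theorem packComplex_equiv_wedge_packBase (ht : 1 ≤ t) (hm : k * t ≤ m)
    (x : realization (packComplex t k (m + 1))) (y : realization (suspension (packBase t k m))) :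
    Nonempty (realization (packComplex t (k + 1) (m + 1 + t)) ≃ₕ Wedge x y) := by
  obtain ⟨a, ha, hx, hQ⟩ : ∃ (a : Fin (m + 1)) (ha : {a} ∈ packComplex t k (m + 1)),
      Joined x (vertexPoint ha) ∧
        ∀ F : Finset (Fin (m + 1)), F.erase a ∈ packBase t k m → F ∈ packComplex t k (m + 1) := by
    -- For `m = k * t` the complex may be disconnected, so the apex is chosen in the path component
    -- of `x`; otherwise the last vertex works for every `x`.
    rcases hm.eq_or_lt with rfl | hlt
    · obtain ⟨a, ha, hx⟩ := exists_joined_vertexPoint x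
      exact ⟨a, ha, hx, fun F hF => mem_of_erase_mem_packBase_of_tight ha F hF ht⟩
    · exact ⟨Fin.last m, last_mem_packComplex hm, joined_packComplex ht (by omega) _ _,
        mem_of_erase_last_mem_packBase⟩
  obtain ⟨q, -, hq⟩ := coneAttach_equiv_wedge_of_joined (empty_mem_packBase hm) hQ ha hx y
  obtain ⟨d, hd⟩ := packComplex_equiv_coneAttach ht hm
    (pushforward _ (mapComplex_some_le_coneAttach _ (packBase t k m)) x)
  exact (hd.trans hq).nonempty_homotopyEquiv

theorem mapComplex_suspension_lastEmbedding :
    mapComplex ((lastEmbedding m).sumMap (Function.Embedding.refl Bool))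
      (suspension (coneAttach (packComplex t k m) (packComplex t (k + 1) m))) =
        suspension (packBase t k m) := by
  rw [mapComplex_suspension, mapComplex_lastEmbedding]

theorem packComplex_equiv_wedge_two (ht : 1 ≤ t) (hm : k * t ≤ m) (hm' : m < (k + 1) * t)
    (x : realization (packComplex t k (m + 1)))
    (y : realization (suspension (packComplex t k m))) :
    Nonempty (realization (packComplex t (k + 1) (m + 1 + t)) ≃ₕ Wedge x y) := by
  have h1 : mapComplex (Function.Embedding.some.sumMap (Function.Embedding.refl Bool))
      (suspension (packComplex t k m)) =
        suspension (coneAttach (packComplex t k m) (packComplex t (k + 1) m)) := by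
    rw [mapComplex_suspension, mapComplex_some_eq_coneAttach_bot, packComplex_eq_bot hm']
  obtain ⟨y₁, hy₁⟩ := exists_pointedEquiv_of_mapComplex_eq h1 y
  obtain ⟨y₂, hy₂⟩ := exists_pointedEquiv_of_mapComplex_eq mapComplex_suspension_lastEmbedding y₁
  obtain ⟨e⟩ := packComplex_equiv_wedge_packBase ht hm x y₂
  obtain ⟨e'⟩ := (Wedge.pointedEquiv_right x (hy₂.trans hy₁) x).nonempty_homotopyEquiv
  exact ⟨e.trans e'⟩

/-- The suspension of `packBase` is itself a cone attachment between suspensions and splits by the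
same wedge lemma, with the last vertex of `packComplex t k m` as apex. This suspension is path
connected, so `y` is arbitrary. -/
theorem packComplex_equiv_wedge_three (ht : 1 ≤ t) (hm : (k + 1) * t ≤ m)
    (x : realization (packComplex t k (m + 1)))
    (y : realization (suspension (packComplex t k m)))
    (z : realization (suspension (suspension (packComplex t (k + 1) m)))) :
    Nonempty (realization (packComplex t (k + 1) (m + 1 + t)) ≃ₕ
      Wedge (Wedge.base x y) z) := by
  have hkm : k * t + t ≤ m := by rwa [Nat.succ_mul] at hm
  obtain ⟨r, rfl⟩ : ∃ r, m = r + 1 := ⟨m - 1, by omega⟩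
  have hB : ∅ ∈ packComplex t (k + 1) (r + 1) := empty_mem_packComplex hm
  have hr : {Fin.last r} ∈ packComplex t k (r + 1) := last_mem_packComplex (by omega)
  have ha : {Sum.inl (Fin.last r)} ∈ suspension (packComplex t k (r + 1)) := by
    refine mem_suspension.2 ⟨?_, ?_⟩
    · convert hr; ext; simp
    · have : (({Sum.inl (Fin.last r)} : Finset (Fin (r + 1) ⊕ Bool))).toRight = ∅ := by
        ext; simp
      simp [this]
  have hQ : ∀ F : Finset (Fin (r + 1) ⊕ Bool),
      F.erase (Sum.inl (Fin.last r)) ∈ suspension (packComplex t (k + 1) (r + 1)) →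
        F ∈ suspension (packComplex t k (r + 1)) := by
    intro F hF
    have h1 : (F.erase (Sum.inl (Fin.last r))).toLeft = F.toLeft.erase (Fin.last r) := by
      ext; simp
    have h2 : (F.erase (Sum.inl (Fin.last r))).toRight = F.toRight := by
      ext; simp
    rw [mem_suspension, h1, h2] at hF
    exact ⟨mem_of_erase_mem_packComplex ht _ hF.1, hF.2⟩
  obtain ⟨q, hq, hyq⟩ := coneAttach_equiv_wedge_of_joined
    (L := suspension (packComplex t (k + 1) (r + 1))) (empty_mem_suspension hB) hQ ha (joined_suspension hr y _) z
  obtain ⟨y₁, hy₁⟩ := exists_pointedEquiv_of_eq_mapComplex mapComplex_suspension_coneAttach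
    (pushforward _ (mapComplex_some_le_coneAttach (suspension (packComplex t k (r + 1)))
      (suspension (packComplex t (k + 1) (r + 1)))) y)
  obtain ⟨y₂, hy₂⟩ := exists_pointedEquiv_of_mapComplex_eq mapComplex_suspension_lastEmbedding y₁
  obtain ⟨e₁⟩ := packComplex_equiv_wedge_packBase ht (by omega) x y₂
  obtain ⟨e₂⟩ := (Wedge.pointedEquiv_right x (hy₂.trans (hy₁.trans hyq)) x).nonempty_homotopyEquiv
  obtain ⟨e₃⟩ := (Wedge.pointedEquiv_of_joined_right
    (wellPointed_realization x) hq q).nonempty_homotopyEquiv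
  exact ⟨e₁.trans (e₂.trans (e₃.trans (Wedge.assoc x y z).toHomotopyEquiv))⟩

end Decomposition

end PathPowers

open PathPowers in
theorem mainTheorem9 (K : Type*) [Field K] (n k l t : ℕ) (hk : 1 ≤ k) (ht : 1 ≤ t) (hl : 1 ≤ l)
    (hn : n = k * t + l) :
    Nonempty (realization (pathComplex K (n - t) t (k - 1))) ∧
    Nonempty (realization (suspension (pathComplex K (n - t - 1) t (k - 1)))) ∧
    (l ≤ t →
      ∀ (x : realization (pathComplex K (n - t) t (k - 1)))
        (y : realization (suspension (pathComplex K (n - t - 1) t (k - 1)))),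
        Nonempty (realization (pathComplex K n t k) ≃ₕ Wedge x y)) ∧
    (t < l →
      Nonempty (realization (suspension (suspension (pathComplex K (n - t - 1) t k)))) ∧
      ∀ (x : realization (pathComplex K (n - t) t (k - 1)))
        (y : realization (suspension (pathComplex K (n - t - 1) t (k - 1))))
        (z : realization (suspension (suspension (pathComplex K (n - t - 1) t k)))),
        Nonempty (realization (pathComplex K n t k) ≃ₕ Wedge (Wedge.base x y) z)) := by
  obtain ⟨k, rfl⟩ : ∃ j, k = j + 1 := ⟨k - 1, by omega⟩
  -- Now `m = k * t + l - 1` for the lowered `k`, so `l ≤ t` becomes `m < (k + 1) * t`.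
  obtain ⟨m, rfl⟩ : ∃ m, n = m + 1 + t := ⟨n - 1 - t, by rw [Nat.succ_mul] at hn; omega⟩
  have hn' : m + 1 = k * t + l := by rw [Nat.succ_mul] at hn; omega
  rw [Nat.add_sub_cancel, Nat.add_sub_cancel, Nat.add_sub_cancel, pathComplex_eq K (m + 1) t ht k,
    pathComplex_eq K m t ht k, pathComplex_eq K m t ht (k + 1),
    pathComplex_eq K (m + 1 + t) t ht (k + 1)]
  have hm : k * t ≤ m := by omega
  refine ⟨⟨vertexPoint (last_mem_packComplex hm)⟩,
    nonempty_realization_suspension (empty_mem_packComplex hm),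
    fun hlt x y => packComplex_equiv_wedge_two ht hm (by rw [Nat.succ_mul]; omega) x y,
    fun hlt => ?_⟩
  have hm' : (k + 1) * t ≤ m := by rw [Nat.succ_mul]; omega
  exact ⟨nonempty_realization_suspension (empty_mem_suspension
    (empty_mem_packComplex hm')),
    fun x y z => packComplex_equiv_wedge_three ht hm' x y z⟩
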